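/- **Double categories.** A double category $\mathcal C=(\mathcal E,\mathcal M)$ consists of two categories $\mathcal E$ (e-morphisms) and $\mathcal M$ (m-morphisms) with the same objects, together with a collection of distinguished squares $$\begin{array}{ccc}A&\xrightarrow{\,t\,}&B\\ {\scriptstyle l}\downarrow&&\downarrow{\scriptstyle r}\\ D&\xrightarrow{\,b\,}&E\end{array}\qquad t,b\in\mathcal M,\quad l,r\in\mathcal E,$$ written $(t;l,r;b)$, which contains the identity squares $(f;1,1;f)$ and $(1;g,g;1)$, is closed under horizontal and vertical gluing, and is such that, for isomorphisms $f,f'$ of $\mathcal M$, the square $(f;g,g';f')$ is distinguished if and only if $(f^{-1};g',g;f'^{-1})$ is. Let $\mathrm{Ar}_\square\mathcal M$ (resp. $\mathrm{Ar}_\square\mathcal E$) be the category whose objects are the m-morphisms (resp. e-morphisms) and whose morphisms from $t$ to $b$ (resp. from $l$ to $r$) are the distinguished squares $(t;l,r;b)$. For a category $\mathcal D$, let $\mathrm{Ar}_\triangle\mathcal D$ be the category whose objects are the morphisms of $\mathcal D$ and whose morphisms from $A\to B$ to $A'\to B'$ are the commutative squares in which $A\to A'$ is an isomorphism. **CGW-categories.**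 A CGW-category is a double category $\mathcal C=(\mathcal E,\mathcal M)$ with an isomorphism of categories $\varphi:\mathrm{iso}\,\mathcal E\to\mathrm{iso}\,\mathcal M$ that is the identity on objects, and equivalences of categories $c:\mathrm{Ar}_\square\mathcal M\to\mathrm{Ar}_\triangle\mathcal E$ and $k:\mathrm{Ar}_\square\mathcal E\to\mathrm{Ar}_\triangle\mathcal M$ compatible with codomains: $c$ sends $f:A\to B$ to an e-morphism $f^c:A^{c/f}\to B$ and a distinguished square $(t;l,r;b)$ to a square with $r$ between the codomains; $k$ sends $g:A\to B$ to an m-morphism $g^k:A^{k/g}\to B$ and a distinguished square $(t;l,r;b)$ to a square with $b$ between the codomains. These satisfy: (Z) there is an object $\varnothing$ that is initial in both $\mathcal E$ and $\mathcal M$; (I) for every isomorphism $f:A\to B$ of $\mathcal E$, also regarded as an isomorphism of $\mathcal M$ through $\varphi$, the squares $(f;f,1_B;1_B)$, $(1_A;1_A,f;f)$, $(f;1_A,f^{-1};1_A)$, $(1_A;f,1_A;f^{-1})$ are distinguished; (M) all morphisms of $\mathcal E$ and of $\mathcal M$ are monic; (K) for every e-morphism $g:A\to B$ there is a distinguished square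 with top $\varnothing\to A$, left $\varnothing\to A^{k/g}$, right $g$ and bottom $g^k$; for every m-morphism $f:A\to B$ there is a distinguished square with top $\varnothing\to A^{c/f}$, left $\varnothing\to A$, right $f^c$ and bottom $f$; (A) for all objects $A,B$ there are an object $X$ and distinguished squares with corners $\varnothing,A,B,X$ and $\varnothing,B,A,X$ (top left, top right, bottom left, bottom right). **The category $Q\mathcal C$.** It has the objects of $\mathcal C$. A morphism $A\to B$ is an equivalence class of diagrams $A\xrightarrow{e}X\xrightarrow{m}B$ with $e\in\mathcal E$ and $m\in\mathcal M$; here $(e,X,m)\sim(e',X',m')$ if there is an isomorphism $i:X\to X'$ of $\mathcal E$ with $ie=e'$ and $m'\varphi(i)=m$. The composite of $A\xrightarrow{e}X\xrightarrow{m}B$ and $B\xrightarrow{e'}Y\xrightarrow{m'}D$ is represented by $A\xrightarrow{le}Z\xrightarrow{m'b}D$, where $(m;l,e';b)$ is a distinguished square with top $m:X\to B$, left $l:X\to Z$, right $e':B\to Y$ and bottom $b:Z\to Y$ (such a square exists and is unique up to unique isomorphism). Let $|Q\mathcal C|$ be the geometric realization of the nerve of $Q\mathcal C$, and let $K_0(\mathcal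 C)=\pi_1(|Q\mathcal C|,\varnothing)$ (that is, $\pi_0$ of $K(\mathcal C)=\Omega|Q\mathcal C|$). **Theorem.** Let $\mathcal C$ be a CGW-category. Then $K_0(\mathcal C)$ is the free abelian group generated by the objects of $\mathcal C$, modulo the relation $[\varnothing]=0$ and the relations $$[D]+[B]=[A]+[E]$$ for all distinguished squares with top row $A\to B$ and bottom row $D\to E$. More precisely, there is an isomorphism from this abelian group to $\pi_1(|Q\mathcal C|,\varnothing)$ that sends the generator $[A]$ to the class of the loop that runs from $\varnothing$ to $A$ along the edge of the morphism $\varnothing\to A\xrightarrow{1}A$ of $Q\mathcal C$ and back along the edge of the morphism $\varnothing\xrightarrow{1}\varnothing\to A$. -/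

import Mathlib

open CategoryTheory CategoryTheory.Limits Opposite Simplicial

universe v w u

/-! ### Double categories

The objects form a type `C`.  The wrappers `EObj C` and `MObj C` are two copies of `C`, carrying the
category `E` of e-morphisms (vertical) and the category `M` of m-morphisms (horizontal). -/

/-- The objects of `C`, regarded as objects of the category of e-morphisms. -/
structure EObj (C : Type u) where
  /-- the underlying object -/
  obj : C

/-- The objects of `C`, regarded as objects of the category of m-morphisms. -/
structure MObj (C : Type u) where
  /-- the underlying object -/
  obj : C

/-- e-morphisms `A ⟶ₑ B` -/
abbrev EHom {C : Type u} [Category.{v} (EObj C)] (A B : C) : Type v :=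
  (EObj.mk A ⟶ EObj.mk B)

/-- m-morphisms `A ⟶ₘ B` -/
abbrev MHom {C : Type u} [Category.{w} (MObj C)] (A B : C) : Type w :=
  (MObj.mk A ⟶ MObj.mk B)

/-- isomorphisms of the category of e-morphisms -/
abbrev EIso {C : Type u} [Category.{v} (EObj C)] (A B : C) : Type v :=
  (EObj.mk A ≅ EObj.mk B)

/-- isomorphisms of the category of m-morphisms -/
abbrev MIso {C : Type u} [Category.{w} (MObj C)] (A B : C) : Type w :=
  (MObj.mk A ≅ MObj.mk B)

infixr:10 " ⟶ₑ " => EHom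
infixr:10 " ⟶ₘ " => MHom
infix:10 " ≅ₑ " => EIso
infix:10 " ≅ₘ " => MIso

/-- A double category with objects `C`, categories `E` and `M` on these objects, and a collection of
distinguished squares.  `IsDist t l r b` says that the square with top
`t : A ⟶ₘ B`, left `l : A ⟶ₑ D`, right `r : B ⟶ₑ E` and bottom `b : D ⟶ₘ E` is distinguished. -/
structure DoubleCat (C : Type u) [Category.{v} (EObj C)] [Category.{w} (MObj C)] where
  IsDist : ∀ {A B D E : C}, (A ⟶ₘ B) → (A ⟶ₑ D) → (B ⟶ₑ E) → (D ⟶ₘ E) → Prop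
  /-- identity squares for vertical composition -/
  dist_idE : ∀ {A B : C} (f : A ⟶ₘ B), IsDist f (𝟙 _) (𝟙 _) f
  /-- identity squares for horizontal composition -/
  dist_idM : ∀ {A B : C} (g : A ⟶ₑ B), IsDist (𝟙 _) g g (𝟙 _)
  /-- horizontal gluing -/
  dist_hcomp : ∀ {A B B' D E E' : C} {t : A ⟶ₘ B} {t' : B ⟶ₘ B'} {l : A ⟶ₑ D} {m : B ⟶ₑ E}
    {r : B' ⟶ₑ E'} {b : D ⟶ₘ E} {b' : E ⟶ₘ E'},
    IsDist t l m b → IsDist t' m r b' → IsDist (t ≫ t') l r (b ≫ b')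
  /-- vertical gluing -/
  dist_vcomp : ∀ {A B D E D' E' : C} {t : A ⟶ₘ B} {l : A ⟶ₑ D} {r : B ⟶ₑ E} {m : D ⟶ₘ E}
    {l' : D ⟶ₑ D'} {r' : E ⟶ₑ E'} {b : D' ⟶ₘ E'},
    IsDist t l r m → IsDist m l' r' b → IsDist t (l ≫ l') (r ≫ r') b
  /-- a square whose horizontal morphisms are isomorphisms may be read backwards -/
  dist_symm : ∀ {A B D E : C} (f : A ≅ₘ B) (f' : D ≅ₘ E) (g : A ⟶ₑ D) (g' : B ⟶ₑ E),
    IsDist f.hom g g' f'.hom ↔ IsDist f.inv g' g f'.inv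

/-! ### The category `Ar_△ D` -/

/-- Objects of `Ar_△ D`: the morphisms of `D`. -/
structure ArTri (D : Type u) [Category.{v} D] where
  {left : D}
  {right : D}
  hom : left ⟶ right

/-- Morphisms of `Ar_△ D`: commutative squares whose top morphism is an isomorphism. -/
@[ext]
structure ArTri.Hom {D : Type u} [Category.{v} D] (f f' : ArTri D) where
  left : f.left ≅ f'.left
  right : f.right ⟶ f'.right
  w : f.hom ≫ right = left.hom ≫ f'.hom

instance ArTri.category (D : Type u) [Category.{v} D] : Category (ArTri D) where
  Hom f f' := ArTri.Hom f f'
  id f := ⟨Iso.refl _, 𝟙 _, by simp⟩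
  comp s t := ⟨s.left ≪≫ t.left, s.right ≫ t.right, by
    rw [← Category.assoc, s.w, Category.assoc, t.w, Iso.trans_hom, Category.assoc]⟩
  id_comp s := by apply ArTri.Hom.ext <;> simp
  comp_id s := by apply ArTri.Hom.ext <;> simp
  assoc s t r := by apply ArTri.Hom.ext <;> simp

namespace DoubleCat

variable {C : Type u} [Category.{v} (EObj C)] [Category.{w} (MObj C)]

/-! ### The categories `Ar_□ M` and `Ar_□ E` -/

/-- Objects of `Ar_□ M`: the m-morphisms. -/
structure ArM (S : DoubleCat C) where
  {left : C}
  {right : C}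
  hom : left ⟶ₘ right

/-- Morphisms of `Ar_□ M`: the distinguished squares, going down. -/
@[ext]
structure ArM.Hom {S : DoubleCat C} (f f' : S.ArM) where
  left : f.left ⟶ₑ f'.left
  right : f.right ⟶ₑ f'.right
  dist : S.IsDist f.hom left right f'.hom

instance (S : DoubleCat C) : Category S.ArM where
  Hom f f' := ArM.Hom f f'
  id f := ⟨𝟙 _, 𝟙 _, S.dist_idE _⟩
  comp s t := ⟨s.left ≫ t.left, s.right ≫ t.right, S.dist_vcomp s.dist t.dist⟩
  id_comp s := by apply ArM.Hom.ext <;> simp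
  comp_id s := by apply ArM.Hom.ext <;> simp
  assoc s t r := by apply ArM.Hom.ext <;> simp

/-- Objects of `Ar_□ E`: the e-morphisms. -/
structure ArE (S : DoubleCat C) where
  {left : C}
  {right : C}
  hom : left ⟶ₑ right

/-- Morphisms of `Ar_□ E`: the distinguished squares, going to the right. -/
@[ext]
structure ArE.Hom {S : DoubleCat C} (g g' : S.ArE) where
  left : g.left ⟶ₘ g'.left
  right : g.right ⟶ₘ g'.right
  dist : S.IsDist left g.hom g'.hom right

instance (S : DoubleCat C) : Category S.ArE where
  Hom g g' := ArE.Hom g g'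
  id g := ⟨𝟙 _, 𝟙 _, S.dist_idM _⟩
  comp s t := ⟨s.left ≫ t.left, s.right ≫ t.right, S.dist_hcomp s.dist t.dist⟩
  id_comp s := by apply ArE.Hom.ext <;> simp
  comp_id s := by apply ArE.Hom.ext <;> simp
  assoc s t r := by apply ArE.Hom.ext <;> simp

/-- A functor `c : Ar_□ M ⥤ Ar_△ E` over the codomain functors to `E`: it sends `f : A ⟶ₘ B` to an
e-morphism `f^c : A^{c/f} ⟶ₑ B` with the same codomain, and a distinguished square to a
commutative square in `E` with the same e-morphism between the codomains. -/
structure CFunctor (S : DoubleCat C) where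
  obj : ∀ {A B : C}, (A ⟶ₘ B) → C
  hom : ∀ {A B : C} (f : A ⟶ₘ B), obj f ⟶ₑ B
  map : ∀ {f f' : S.ArM}, (f ⟶ f') → (obj f.hom ≅ₑ obj f'.hom)
  w : ∀ {f f' : S.ArM} (s : f ⟶ f'), hom f.hom ≫ ArM.Hom.right s = (map s).hom ≫ hom f'.hom
  map_id : ∀ f : S.ArM, map (𝟙 f) = Iso.refl _
  map_comp : ∀ {f f' f'' : S.ArM} (s : f ⟶ f') (t : f' ⟶ f''), map (s ≫ t) = map s ≪≫ map t

/-- A functor `k : Ar_□ E ⥤ Ar_△ M` over the codomain functors to `M`: it sends `g : A ⟶ₑ B` to an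
m-morphism `g^k : A^{k/g} ⟶ₘ B` with the same codomain, and a distinguished square to a
commutative square in `M` with the same m-morphism between the codomains. -/
structure KFunctor (S : DoubleCat C) where
  obj : ∀ {A B : C}, (A ⟶ₑ B) → C
  hom : ∀ {A B : C} (g : A ⟶ₑ B), obj g ⟶ₘ B
  map : ∀ {g g' : S.ArE}, (g ⟶ g') → (obj g.hom ≅ₘ obj g'.hom)
  w : ∀ {g g' : S.ArE} (s : g ⟶ g'), hom g.hom ≫ ArE.Hom.right s = (map s).hom ≫ hom g'.hom
  map_id : ∀ g : S.ArE, map (𝟙 g) = Iso.refl _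
  map_comp : ∀ {g g' g'' : S.ArE} (s : g ⟶ g') (t : g' ⟶ g''), map (s ≫ t) = map s ≪≫ map t

/-- `c` as a functor. -/
def CFunctor.functor {S : DoubleCat C} (c : S.CFunctor) : S.ArM ⥤ ArTri (EObj C) where
  obj f := ⟨c.hom f.hom⟩
  map s := ⟨c.map s, ArM.Hom.right s, c.w s⟩
  map_id f := ArTri.Hom.ext (c.map_id f) rfl
  map_comp s t := ArTri.Hom.ext (c.map_comp s t) rfl

/-- `k` as a functor. -/
def KFunctor.functor {S : DoubleCat C} (k : S.KFunctor) : S.ArE ⥤ ArTri (MObj C) where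
  obj g := ⟨k.hom g.hom⟩
  map s := ⟨k.map s, ArE.Hom.right s, k.w s⟩
  map_id g := ArTri.Hom.ext (k.map_id g) rfl
  map_comp s t := ArTri.Hom.ext (k.map_comp s t) rfl

end DoubleCat

/-! ### CGW-categories -/

/-- A CGW-category `(C, φ, c, k)` with objects `C`. -/
structure CGWCategory (C : Type u) [Category.{v} (EObj C)] [Category.{w} (MObj C)]
    extends DoubleCat C where
  /-- the isomorphism of categories `φ : iso E ⥤ iso M`, the identity on objects -/
  phi : ∀ {A B : C}, (A ≅ₑ B) ≃ (A ≅ₘ B)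
  phi_refl : ∀ A : C, phi (Iso.refl (EObj.mk A)) = Iso.refl _
  phi_trans : ∀ {A B D : C} (i : A ≅ₑ B) (j : B ≅ₑ D), phi (i ≪≫ j) = phi i ≪≫ phi j
  /-- the equivalence `c` -/
  c : toDoubleCat.CFunctor
  c_equiv : c.functor.IsEquivalence
  /-- the equivalence `k` -/
  k : toDoubleCat.KFunctor
  k_equiv : k.functor.IsEquivalence
  /-- axiom (Z): an object that is initial in both categories -/
  zero : C
  zeroE : IsInitial (EObj.mk zero)
  zeroM : IsInitial (MObj.mk zero)
  /-- axiom (I), the four squares of an isomorphism -/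
  dist_iso₁ : ∀ {A B : C} (f : A ≅ₑ B), IsDist (phi f).hom f.hom (𝟙 _) (𝟙 _)
  dist_iso₂ : ∀ {A B : C} (f : A ≅ₑ B), IsDist (𝟙 _) (𝟙 _) f.hom (phi f).hom
  dist_iso₃ : ∀ {A B : C} (f : A ≅ₑ B), IsDist (phi f).hom (𝟙 _) f.inv (𝟙 _)
  dist_iso₄ : ∀ {A B : C} (f : A ≅ₑ B), IsDist (𝟙 _) f.hom (𝟙 _) (phi f).inv
  /-- axiom (M) -/
  monoE : ∀ {A B : C} (g : A ⟶ₑ B), Mono g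
  monoM : ∀ {A B : C} (f : A ⟶ₘ B), Mono f
  /-- axiom (K) for `k` -/
  dist_k : ∀ {A B : C} (g : A ⟶ₑ B), IsDist (zeroM.to _) (zeroE.to _) g (k.hom g)
  /-- axiom (K) for `c` -/
  dist_c : ∀ {A B : C} (f : A ⟶ₘ B), IsDist (zeroM.to _) (zeroE.to _) (c.hom f) f
  /-- axiom (A) -/
  exists_sum : ∀ A B : C, ∃ X : C,
    (∃ (g : A ⟶ₑ X) (f : B ⟶ₘ X), IsDist (zeroM.to _) (zeroE.to _) g f) ∧
    (∃ (g : B ⟶ₑ X) (f : A ⟶ₘ X), IsDist (zeroM.to _) (zeroE.to _) g f)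

namespace CGWCategory

variable {C : Type u} [Category.{v} (EObj C)] [Category.{w} (MObj C)] (S : CGWCategory C)

lemma phi_symm {A B : C} (i : A ≅ₑ B) : S.phi i.symm = (S.phi i).symm := by
  have h : S.phi i ≪≫ S.phi i.symm = Iso.refl _ := by
    rw [← S.phi_trans, Iso.self_symm_id, S.phi_refl]
  ext
  rw [Iso.symm_hom, ← cancel_epi (S.phi i).hom, Iso.hom_inv_id]
  exact congrArg Iso.hom h

/-- A distinguished square is determined by its top, right and bottom morphisms. -/
lemma dist_left_unique {A B D E : C} {t : A ⟶ₘ B} {l l' : A ⟶ₑ D} {r : B ⟶ₑ E} {b : D ⟶ₘ E}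
    (h : S.IsDist t l r b) (h' : S.IsDist t l' r b) : l = l' := by
  have := S.c_equiv
  let F : S.toDoubleCat.ArM := ⟨t⟩
  let G : S.toDoubleCat.ArM := ⟨b⟩
  let s : F ⟶ G := ⟨l, r, h⟩
  let s' : F ⟶ G := ⟨l', r, h'⟩
  have e : s = s' := by
    apply S.c.functor.map_injective
    refine ArTri.Hom.ext (Iso.ext ?_) rfl
    exact (S.monoE (S.c.hom b)).right_cancellation _ _ ((S.c.w s).symm.trans (S.c.w s'))
  exact congrArg DoubleCat.ArM.Hom.left e

/-- A distinguished square is determined by its left, right and bottom morphisms. -/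
lemma dist_top_unique {A B D E : C} {t t' : A ⟶ₘ B} {l : A ⟶ₑ D} {r : B ⟶ₑ E} {b : D ⟶ₘ E}
    (h : S.IsDist t l r b) (h' : S.IsDist t' l r b) : t = t' := by
  have := S.k_equiv
  let F : S.toDoubleCat.ArE := ⟨l⟩
  let G : S.toDoubleCat.ArE := ⟨r⟩
  let s : F ⟶ G := ⟨t, b, h⟩
  let s' : F ⟶ G := ⟨t', b, h'⟩
  have e : s = s' := by
    apply S.k.functor.map_injective
    refine ArTri.Hom.ext (Iso.ext ?_) rfl
    exact (S.monoM (S.k.hom r)).right_cancellation _ _ ((S.k.w s).symm.trans (S.k.w s'))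
  exact congrArg DoubleCat.ArE.Hom.left e

/-- Prolonging a distinguished square by an isomorphism at its lower right corner. -/
lemma dist_below {D E E' : C} (b : D ⟶ₘ E) (j : E ≅ₑ E') :
    S.IsDist b (𝟙 _) j.hom (b ≫ (S.phi j).hom) := by
  simpa using S.dist_hcomp (S.dist_idE b) (S.dist_iso₂ j)

/-- Completing `A ⟶ₘ B ⟶ₑ E` to a distinguished square. -/
lemma exists_dist {A B E : C} (f : A ⟶ₘ B) (g : B ⟶ₑ E) :
    ∃ (D : C) (l : A ⟶ₑ D) (b : D ⟶ₘ E), S.IsDist f l g b := by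
  have := S.c_equiv
  let T : ArTri (EObj C) := ⟨S.c.hom f ≫ g⟩
  let F : S.toDoubleCat.ArM := ⟨f⟩
  let G := S.c.functor.objPreimage T
  let θ : S.c.functor.obj G ≅ T := S.c.functor.objObjPreimageIso T
  let u : S.c.functor.obj F ⟶ T := ⟨Iso.refl _, g, by simp [T, F, DoubleCat.CFunctor.functor]⟩
  obtain ⟨s, hs⟩ := S.c.functor.map_surjective (u ≫ θ.inv)
  let j : G.right ≅ₑ E :=
    ⟨ArTri.Hom.right θ.hom, ArTri.Hom.right θ.inv, congrArg ArTri.Hom.right θ.hom_inv_id,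
      congrArg ArTri.Hom.right θ.inv_hom_id⟩
  refine ⟨G.left, s.left, G.hom ≫ (S.phi j).hom, ?_⟩
  have h := S.dist_vcomp s.dist (S.dist_below G.hom j)
  have e : s.right ≫ j.hom = g := by
    have hr : s.right = g ≫ j.inv := congrArg ArTri.Hom.right hs
    rw [hr, Category.assoc, j.inv_hom_id, Category.comp_id]
  rw [e, Category.comp_id] at h
  exact h

/-- The completion of `A ⟶ₘ B ⟶ₑ E` to a distinguished square is unique up to isomorphism. -/
lemma dist_unique {A B E D D' : C} {f : A ⟶ₘ B} {g : B ⟶ₑ E} {l : A ⟶ₑ D} {b : D ⟶ₘ E}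
    {l' : A ⟶ₑ D'} {b' : D' ⟶ₘ E} (h : S.IsDist f l g b) (h' : S.IsDist f l' g b') :
    ∃ i : D ≅ₑ D', l ≫ i.hom = l' ∧ (S.phi i).hom ≫ b' = b := by
  have := S.c_equiv
  let F : S.toDoubleCat.ArM := ⟨f⟩
  let G : S.toDoubleCat.ArM := ⟨b⟩
  let G' : S.toDoubleCat.ArM := ⟨b'⟩
  let s : F ⟶ G := ⟨l, g, h⟩
  let s' : F ⟶ G' := ⟨l', g, h'⟩
  let p : S.c.functor.obj G ⟶ S.c.functor.obj G' :=
    ⟨(S.c.map s).symm ≪≫ S.c.map s', 𝟙 _, by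
      have h₁ : S.c.hom f ≫ g = (S.c.map s).hom ≫ S.c.hom b := S.c.w s
      have h₂ : S.c.hom f ≫ g = (S.c.map s').hom ≫ S.c.hom b' := S.c.w s'
      change S.c.hom b ≫ 𝟙 _ = ((S.c.map s).inv ≫ (S.c.map s').hom) ≫ S.c.hom b'
      rw [Category.comp_id, Category.assoc, ← h₂, h₁, Iso.inv_hom_id_assoc]⟩
  let q : S.c.functor.obj G' ⟶ S.c.functor.obj G :=
    ⟨(S.c.map s').symm ≪≫ S.c.map s, 𝟙 _, by
      have h₁ : S.c.hom f ≫ g = (S.c.map s).hom ≫ S.c.hom b := S.c.w s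
      have h₂ : S.c.hom f ≫ g = (S.c.map s').hom ≫ S.c.hom b' := S.c.w s'
      change S.c.hom b' ≫ 𝟙 _ = ((S.c.map s').inv ≫ (S.c.map s).hom) ≫ S.c.hom b
      rw [Category.comp_id, Category.assoc, ← h₁, h₂, Iso.inv_hom_id_assoc]⟩
  obtain ⟨t, ht⟩ := S.c.functor.map_surjective p
  obtain ⟨t', ht'⟩ := S.c.functor.map_surjective q
  have hr : t.right = 𝟙 _ := congrArg ArTri.Hom.right ht
  have hr' : t'.right = 𝟙 _ := congrArg ArTri.Hom.right ht'
  have d : S.IsDist b t.left (𝟙 _) b' := hr ▸ t.dist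
  have d' : S.IsDist b' t'.left (𝟙 _) b := hr' ▸ t'.dist
  let i : D ≅ₑ D' :=
    ⟨t.left, t'.left,
      S.dist_left_unique (by simpa using S.dist_vcomp d d') (S.dist_idE b),
      S.dist_left_unique (by simpa using S.dist_vcomp d' d) (S.dist_idE b')⟩
  refine ⟨i, S.dist_left_unique (by simpa using S.dist_vcomp h d) h', ?_⟩
  have e : (S.phi i).inv ≫ b = b' := by
    have h₃ := S.dist_iso₃ i.symm
    rw [S.phi_symm] at h₃
    exact S.dist_top_unique (by simpa using S.dist_hcomp h₃ d) (S.dist_idE b')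
  rw [← e, Iso.hom_inv_id_assoc]

/-! ### The category `Q C` -/

/-- The objects of `Q C`. -/
structure Q (S : CGWCategory C) where
  /-- the underlying object -/
  obj : C

/-- A diagram `A ⟶ₑ X ⟶ₘ B`. -/
structure QSpan (A B : C) where
  {mid : C}
  e : A ⟶ₑ mid
  m : mid ⟶ₘ B

/-- Two diagrams `A ⟶ₑ X ⟶ₘ B`, `A ⟶ₑ X' ⟶ₘ B` are equivalent if some isomorphism `X ≅ X'` makes
the left triangle commute in `E` and the right triangle commute in `M`. -/
def qSetoid (A B : C) : Setoid (QSpan A B) where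
  r p q := ∃ i : p.mid ≅ₑ q.mid, p.e ≫ i.hom = q.e ∧ (S.phi i).hom ≫ q.m = p.m
  iseqv :=
    { refl := fun p ↦ ⟨Iso.refl _, by simp, by simp [S.phi_refl]⟩
      symm := by
        rintro p q ⟨i, h₁, h₂⟩
        refine ⟨i.symm, by simp [← h₁], by simp [S.phi_symm, ← h₂]⟩
      trans := by
        rintro p q r ⟨i, h₁, h₂⟩ ⟨j, h₃, h₄⟩
        refine ⟨i ≪≫ j, ?_, ?_⟩
        · rw [Iso.trans_hom, ← Category.assoc, h₁, h₃]
        · rw [S.phi_trans, Iso.trans_hom, Category.assoc, h₄, h₂] }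

/-- The morphisms of `Q C`: equivalence classes of diagrams. -/
def QHom (A B : C) := Quotient (S.qSetoid A B)

/-- The class of a diagram. -/
def qMk {A X B : C} (e : A ⟶ₑ X) (m : X ⟶ₘ B) : S.QHom A B :=
  Quotient.mk (S.qSetoid A B) ⟨e, m⟩

lemma qMk_eq {A X X' B : C} {e : A ⟶ₑ X} {m : X ⟶ₘ B} {e' : A ⟶ₑ X'} {m' : X' ⟶ₘ B}
    (i : X ≅ₑ X') (h₁ : e ≫ i.hom = e') (h₂ : (S.phi i).hom ≫ m' = m) :
    S.qMk e m = S.qMk e' m' :=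
  Quotient.sound (s := S.qSetoid A B) ⟨i, h₁, h₂⟩

/-- The composite of two diagrams, by means of a distinguished square. -/
noncomputable def qCompSpan {A B D : C} (p : QSpan A B) (q : QSpan B D) : QSpan A D :=
  ⟨p.e ≫ (S.exists_dist p.m q.e).choose_spec.choose,
    (S.exists_dist p.m q.e).choose_spec.choose_spec.choose ≫ q.m⟩

/-- Any distinguished square may be used to compute the composite, on any representatives. -/
lemma qCompSpan_eq {A B D X Y Z : C} (p : QSpan A B) (q : QSpan B D)
    {e : A ⟶ₑ X} {m : X ⟶ₘ B} {e' : B ⟶ₑ Y} {m' : Y ⟶ₘ D} {l : X ⟶ₑ Z} {b : Z ⟶ₘ Y}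
    (hp : (S.qSetoid A B).r p ⟨e, m⟩) (hq : (S.qSetoid B D).r q ⟨e', m'⟩)
    (h : S.IsDist m l e' b) :
    Quotient.mk (S.qSetoid A D) (S.qCompSpan p q) = S.qMk (e ≫ l) (b ≫ m') := by
  obtain ⟨i, hi₁, hi₂⟩ := hp
  obtain ⟨j, hj₁, hj₂⟩ := hq
  have d := (S.exists_dist p.m q.e).choose_spec.choose_spec.choose_spec
  set l₀ := (S.exists_dist p.m q.e).choose_spec.choose with hl₀
  set b₀ := (S.exists_dist p.m q.e).choose_spec.choose_spec.choose with hb₀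
  have d₁ : S.IsDist (S.phi i).inv (i.inv ≫ l₀) l₀ (𝟙 _) := by
    have h₁ := S.dist_iso₁ i.symm
    rw [S.phi_symm] at h₁
    simpa using S.dist_vcomp h₁ (S.dist_idM l₀)
  have d₂ := S.dist_vcomp (S.dist_hcomp d₁ d) (S.dist_below _ j)
  have e₁ : (S.phi i).inv ≫ p.m = m := by rw [← hi₂, Iso.inv_hom_id_assoc]
  rw [e₁, hj₁, Category.comp_id, Category.id_comp] at d₂
  obtain ⟨n, hn₁, hn₂⟩ := S.dist_unique d₂ h
  refine S.qMk_eq n ?_ ?_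
  · change (p.e ≫ l₀) ≫ n.hom = e ≫ l
    have hi₃ : p.e ≫ i.hom = e := hi₁
    rw [← hn₁, ← hi₃]
    simp
  · rw [← hj₂, ← Category.assoc, hn₂, Category.assoc]

/-- Composition in `Q C`. -/
noncomputable def qComp {A B D : C} (p : S.QHom A B) (q : S.QHom B D) : S.QHom A D :=
  Quotient.map₂ (sa := S.qSetoid A B) (sb := S.qSetoid B D) (sc := S.qSetoid A D) S.qCompSpan
    (by
      intro p p' hp q q' hq
      have d := (S.exists_dist p'.m q'.e).choose_spec.choose_spec.choose_spec
      exact Quotient.exact (s := S.qSetoid A D) (S.qCompSpan_eq p q hp hq d)) p q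

lemma qComp_mk {A B D X Y Z : C} {e : A ⟶ₑ X} {m : X ⟶ₘ B} {e' : B ⟶ₑ Y} {m' : Y ⟶ₘ D}
    {l : X ⟶ₑ Z} {b : Z ⟶ₘ Y} (h : S.IsDist m l e' b) :
    S.qComp (S.qMk e m) (S.qMk e' m') = S.qMk (e ≫ l) (b ≫ m') :=
  S.qCompSpan_eq ⟨e, m⟩ ⟨e', m'⟩ ((S.qSetoid A B).refl _) ((S.qSetoid B D).refl _) h

noncomputable instance : Category S.Q where
  Hom A B := S.QHom A.obj B.obj
  id A := S.qMk (𝟙 (EObj.mk A.obj)) (𝟙 (MObj.mk A.obj))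
  comp p q := S.qComp p q
  id_comp := by
    intro A B p
    induction p using Quotient.inductionOn with | h p =>
    exact (S.qComp_mk (S.dist_idM p.e)).trans (by rw [Category.id_comp, Category.id_comp]; rfl)
  comp_id := by
    intro A B p
    induction p using Quotient.inductionOn with | h p =>
    exact (S.qComp_mk (S.dist_idE p.m)).trans (by rw [Category.comp_id, Category.comp_id]; rfl)
  assoc := by
    intro A B D E p q r
    induction p using Quotient.inductionOn with | h p =>
    induction q using Quotient.inductionOn with | h q =>
    induction r using Quotient.inductionOn with | h r =>
    obtain ⟨Z, l₁, b₁, h₁⟩ := S.exists_dist p.m q.e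
    obtain ⟨V, l₂, b₂, h₂⟩ := S.exists_dist q.m r.e
    obtain ⟨U, l₃, b₃, h₃⟩ := S.exists_dist b₁ l₂
    change S.qComp (S.qComp (S.qMk p.e p.m) (S.qMk q.e q.m)) (S.qMk r.e r.m) =
      S.qComp (S.qMk p.e p.m) (S.qComp (S.qMk q.e q.m) (S.qMk r.e r.m))
    rw [S.qComp_mk h₁, S.qComp_mk h₂, S.qComp_mk (S.dist_hcomp h₃ h₂),
      S.qComp_mk (S.dist_vcomp h₁ h₃), Category.assoc, Category.assoc]

/-- The morphism `A ⟶ X ⟶ B` of `Q C` represented by a diagram. -/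
def qHom {A X B : C} (e : A ⟶ₑ X) (m : X ⟶ₘ B) : (Q.mk A : S.Q) ⟶ Q.mk B := S.qMk e m

end CGWCategory

/-! ### The classifying space of a category, its points and paths -/

section ClassifyingSpace

variable (D : Type u) [Category.{v} D]

/-- The classifying space `|D|`: the geometric realization of the nerve. -/
noncomputable abbrev ClassifyingSpace : TopCat.{max u v} := SSet.toTop.obj (nerve D)

variable {D}

/-- The point of `|D|` given by an object. -/
noncomputable def classPt (A : D) : ClassifyingSpace D :=
  TopCat.toSSetObj₀Equiv
    ((sSetTopAdj.unit.app (nerve D)).app (op ⦋0⦌) (ComposableArrows.mk₀ A))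

/-- The characteristic map of the `1`-simplex of `|D|` given by a morphism. -/
noncomputable def classEdge {A B : D} (f : A ⟶ B) :
    C(stdSimplex ℝ (Fin 2), ClassifyingSpace D) :=
  TopCat.toSSetObjEquiv _ (op ⦋1⦌)
    ((sSetTopAdj.unit.app (nerve D)).app (op ⦋1⦌) (ComposableArrows.mk₁ f))

lemma classEdge_vertex {A B : D} (f : A ⟶ B) (i : Fin 2) (X : D)
    (hX : (nerve D).map (SimplexCategory.δ i).op (ComposableArrows.mk₁ f) =
      ComposableArrows.mk₀ X) :
    classEdge f (stdSimplex.vertex (i.succAbove 0)) = classPt X := by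
  have h := NatTrans.naturality_apply (sSetTopAdj.unit.app (nerve D)) (SimplexCategory.δ i).op
    (ComposableArrows.mk₁ f)
  have h' := congrArg TopCat.toSSetObj₀Equiv
    ((congrArg ((sSetTopAdj.unit.app (nerve D)).app (op ⦋0⦌)) hX).symm.trans h)
  refine Eq.trans ?_ h'.symm
  refine congrArg (classEdge f) ?_
  refine (stdSimplex.map_vertex (S := ℝ) i.succAbove (0 : Fin 1)).symm.trans ?_
  exact congrArg (stdSimplex.map i.succAbove) (Subsingleton.elim _ _)

/-- The path in `|D|` along the edge given by a morphism `f : A ⟶ B`, from the point `A` to the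
point `B`. -/
noncomputable def classPath {A B : D} (f : A ⟶ B) : Path (classPt A) (classPt B) where
  toFun t := classEdge f (stdSimplexHomeomorphUnitInterval.symm t)
  continuous_toFun := (classEdge f).continuous.comp (Homeomorph.continuous _)
  source' := by
    rw [← stdSimplexHomeomorphUnitInterval_zero, Homeomorph.symm_apply_apply]
    exact classEdge_vertex f 1 A (ComposableArrows.ext₀ rfl)
  target' := by
    rw [← stdSimplexHomeomorphUnitInterval_one, Homeomorph.symm_apply_apply]
    exact classEdge_vertex f 0 B (ComposableArrows.ext₀ rfl)

end ClassifyingSpace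

/-! ### `K₀` -/

namespace CGWCategory

variable {C : Type u} [Category.{v} (EObj C)] [Category.{w} (MObj C)] (S : CGWCategory C)

/-- `K₀(C) = π₁(|Q C|, ∅)`, where `∅` is the object that is initial in `E` and `M`. -/
abbrev K₀ := FundamentalGroup (ClassifyingSpace S.Q) (classPt (Q.mk S.zero))

/-- The class in `π₁(|Q C|, ∅)` of the loop that runs along `∅ ⟶ₑ A ⟶ₘ A` (with the identity of `A`
as m-morphism) from `∅` to `A`, and then back along `∅ ⟶ₑ ∅ ⟶ₘ A` (with the identity of `∅` as
e-morphism). -/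
noncomputable def loopClass (A : C) : S.K₀ :=
  FundamentalGroup.fromPath (Path.Homotopic.Quotient.mk
    ((classPath (S.qHom (S.zeroE.to (EObj.mk A)) (𝟙 (MObj.mk A)))).trans
      (classPath (S.qHom (𝟙 (EObj.mk S.zero)) (S.zeroM.to (MObj.mk A)))).symm))

/-- The relators: `[∅]`, and `[D] + [B] - ([A] + [E])` for every distinguished square with
top row `A ⟶ₘ B` and bottom row `D ⟶ₘ E`. -/
def relators : Set (FreeAbelianGroup C) :=
  insert (FreeAbelianGroup.of S.zero)
    {x | ∃ (A B D E : C) (t : A ⟶ₘ B) (l : A ⟶ₑ D) (r : B ⟶ₑ E) (b : D ⟶ₘ E),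
      S.IsDist t l r b ∧
      x = FreeAbelianGroup.of D + FreeAbelianGroup.of B -
        (FreeAbelianGroup.of A + FreeAbelianGroup.of E)}

/-- The free abelian group on the objects, modulo the relators. -/
abbrev PresentedK₀ := FreeAbelianGroup C ⧸ AddSubgroup.closure S.relators

/-- The class `[A]` of an object. -/
def objClass (A : C) : S.PresentedK₀ := QuotientAddGroup.mk (FreeAbelianGroup.of A)

end CGWCategory

/-! Two homomorphisms between the presented group and `π₁(|Q C|, ∅)` are built independently and
compared on generators.

From the presentation to loops: every object is joined to `∅` by the edge of the m-morphism from `∅`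
(`base`). Edges of m-morphisms then become trivial loops, so a span contributes only the loop of its
e-part (`loop_edge_qHom`). A distinguished square is an equality of composites in `Q C`, hence its
two e-sides have the same loop (`eLoop_dist`). By axiom (K) the loop of any e-morphism is the loop
of an object. Factoring `∅ → B` through an e-morphism `A → B` gives `loopClass_mul`, and axiom (A)
makes the loops of objects commute. The relations follow (`loopClass_dist`).

Back again: sending a span `A → X → B` to `[X] - [A]` is additive under composition (`degree_comp`).
A multiplicative function `F` from the morphisms of a category to a group `G` acts on loops through
a covering (`exists_fundamentalGroup_hom`). Its total space consists of the functions `[0, 1) → G`,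
with distance the measure of the set where they differ; `G` acts by translation, and `g ≠ 1` moves
every function by distance `1`. A point of a simplex cuts `[0, 1)` into blocks, and the values of
`F` on the arrows from the initial vertex give a step function, well defined up to translation. The
edge of `f` lifts to a path from the constant `1` to the constant `F f`.

Injectivity is then a check on generators. Surjectivity needs every path between vertices to be a
composite of edges and their inverses up to homotopy (`edge_induction`). For this, `|D|` is covered
by open sets on which a homotopy ends at one vertex. No vertex need dominate a given point, but
inside a suitable subinterval of `[0, 1)`, a window, a single block does. The homotopy moves a point
towards the positions that dominate its window, positions joined by identities being counted
together so that it respects degeneracies. -/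

/-! ### Maps out of a geometric realization -/

section Realization

variable {X : SSet.{u}}

/-- The characteristic map of a simplex in the geometric realization. -/
noncomputable def simplexMap {n : ℕ} (x : X _⦋n⦌) :
    C(stdSimplex ℝ (Fin (n + 1)), SSet.toTop.obj X) :=
  TopCat.toSSetObjEquiv _ (op ⦋n⦌) ((sSetTopAdj.unit.app X).app (op ⦋n⦌) x)

lemma simplexMap_map {n m : ℕ} (θ : ⦋m⦌ ⟶ ⦋n⦌) (x : X _⦋n⦌) (t : stdSimplex ℝ (Fin (m + 1))) :
    simplexMap (X.map θ.op x) t = simplexMap x (stdSimplex.map θ t) := by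
  have h := NatTrans.naturality_apply (sSetTopAdj.unit.app X) θ.op x
  have h' := congrArg (TopCat.toSSetObjEquiv (SSet.toTop.obj X) (op ⦋m⦌)) h
  refine (DFunLike.congr_fun h' t).trans ?_
  exact TopCat.toSSetObjEquiv_naturality_apply θ ((sSetTopAdj.unit.app X).app (op ⦋n⦌) x) t

/-- A compatible family of continuous maps on the simplices of `X` glues to a continuous map on the
geometric realization. -/
theorem exists_realization_desc (Y : Type u) [TopologicalSpace Y]
    (g : ∀ n : ℕ, X _⦋n⦌ → C(stdSimplex ℝ (Fin (n + 1)), Y))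
    (hg : ∀ {n m : ℕ} (θ : ⦋m⦌ ⟶ ⦋n⦌) (x : X _⦋n⦌) (t : stdSimplex ℝ (Fin (m + 1))),
      g m (X.map θ.op x) t = g n x (stdSimplex.map θ t)) :
    ∃ f : C(SSet.toTop.obj X, Y), ∀ (n : ℕ) (x : X _⦋n⦌) (t : stdSimplex ℝ (Fin (n + 1))),
      f (simplexMap x t) = g n x t := by
  let τ : X ⟶ TopCat.toSSet.obj (TopCat.of Y) :=
    { app := fun n ↦ TypeCat.ofHom fun x ↦
        (TopCat.toSSetObjEquiv (TopCat.of Y) n).symm (g n.unop.len x)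
      naturality := by
        intro n m θ
        ext x
        apply (TopCat.toSSetObjEquiv (TopCat.of Y) m).injective
        ext t
        exact hg (n := n.unop.len) (m := m.unop.len) θ.unop x t }
  let f := (sSetTopAdj.homEquiv X (TopCat.of Y)).symm τ
  refine ⟨f.hom, fun n x t ↦ ?_⟩
  have h : sSetTopAdj.unit.app X ≫ TopCat.toSSet.map f = τ :=
    (sSetTopAdj.homEquiv_unit ..).symm.trans (Equiv.apply_symm_apply _ _)
  have h' := congrArg (fun α : X ⟶ TopCat.toSSet.obj (TopCat.of Y) ↦
    TopCat.toSSetObjEquiv (TopCat.of Y) (op ⦋n⦌) (α.app (op ⦋n⦌) x) t) h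
  exact h'

/-- Two maps on the geometric realization that agree on all simplices are equal. -/
theorem realization_hom_ext {Y : Type u} [TopologicalSpace Y] {f g : C(SSet.toTop.obj X, Y)}
    (h : ∀ (n : ℕ) (x : X _⦋n⦌) (t : stdSimplex ℝ (Fin (n + 1))),
      f (simplexMap x t) = g (simplexMap x t)) : f = g := by
  have h' : TopCat.ofHom f = TopCat.ofHom (Y := Y) g := by
    apply (sSetTopAdj.homEquiv X (TopCat.of Y)).injective
    rw [sSetTopAdj.homEquiv_unit, sSetTopAdj.homEquiv_unit]
    ext n x
    apply (TopCat.toSSetObjEquiv (TopCat.of Y) n).injective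
    ext t
    exact h n.unop.len x t
  exact congrArg TopCat.Hom.hom h'

/-- Every point of the geometric realization lies on some simplex. -/
theorem exists_simplexMap_eq (p : SSet.toTop.obj X) :
    ∃ (n : ℕ) (x : X _⦋n⦌) (t : stdSimplex ℝ (Fin (n + 1))), simplexMap x t = p := by
  -- Every function into an indiscrete space is continuous, so "lies on a simplex" and "true" are
  -- continuous maps that agree on all simplices.
  let : TopologicalSpace (ULift.{u} Prop) := ⊤
  let f : C(SSet.toTop.obj X, ULift.{u} Prop) :=
    ⟨fun p ↦ ⟨∃ (n : ℕ) (x : X _⦋n⦌) (t : stdSimplex ℝ (Fin (n + 1))), simplexMap x t = p⟩,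
      continuous_top⟩
  let g : C(SSet.toTop.obj X, ULift.{u} Prop) := ⟨fun _ ↦ ⟨True⟩, continuous_top⟩
  have hfg : f = g := realization_hom_ext fun n x t ↦ ULift.ext _ _ (eq_true ⟨n, x, t, rfl⟩)
  have := congrArg (fun k : C(SSet.toTop.obj X, ULift.{u} Prop) ↦ (k p).down) hfg
  exact of_eq_true this

end Realization

/-! ### Points of a simplex as divisions of the unit interval into blocks -/

section Blocks

variable {n m : ℕ}

/-- The partial sums of the barycentric coordinates. -/
noncomputable def cumSum (t : stdSimplex ℝ (Fin (n + 1))) (k : ℕ) : ℝ :=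
  ∑ i : Fin (n + 1) with i.val < k, t i

lemma cumSum_zero (t : stdSimplex ℝ (Fin (n + 1))) : cumSum t 0 = 0 := by
  simp [cumSum]

lemma cumSum_last (t : stdSimplex ℝ (Fin (n + 1))) : cumSum t (n + 1) = 1 := by
  rw [cumSum, Finset.filter_true_of_mem (fun i _ ↦ i.isLt), stdSimplex.sum_eq_one]

lemma cumSum_mono (t : stdSimplex ℝ (Fin (n + 1))) : Monotone (cumSum t) := by
  intro k l h
  refine Finset.sum_le_sum_of_subset_of_nonneg ?_ (fun i _ _ ↦ stdSimplex.zero_le t i)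
  intro i
  simp only [Finset.mem_filter, Finset.mem_univ, true_and]
  omega

lemma cumSum_succ (t : stdSimplex ℝ (Fin (n + 1))) (i : Fin (n + 1)) :
    cumSum t (i + 1) = cumSum t i + t i := by
  rw [cumSum, cumSum, add_comm (Finset.sum _ _), ← Finset.sum_insert (by simp)]
  refine Finset.sum_congr ?_ (fun _ _ ↦ rfl)
  ext j
  simp only [Finset.mem_filter, Finset.mem_univ, true_and, Finset.mem_insert, Fin.ext_iff]
  omega

lemma continuous_simplex_apply (i : Fin (n + 1)) :
    Continuous fun t : stdSimplex ℝ (Fin (n + 1)) ↦ t i :=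
  (continuous_apply i).comp continuous_subtype_val

lemma continuous_cumSum (k : ℕ) :
    Continuous fun t : stdSimplex ℝ (Fin (n + 1)) ↦ cumSum t k :=
  continuous_finsetSum _ fun i _ ↦ continuous_simplex_apply i

lemma simplex_map_apply (θ : Fin (m + 1) → Fin (n + 1)) (t : stdSimplex ℝ (Fin (m + 1)))
    (j : Fin (n + 1)) : stdSimplex.map θ t j = ∑ i with θ i = j, t i := by
  rw [stdSimplex.map_coe, FunOnFinite.linearMap_apply_apply]

lemma cumSum_map (θ : Fin (m + 1) → Fin (n + 1)) (t : stdSimplex ℝ (Fin (m + 1))) (k : ℕ) :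
    cumSum (stdSimplex.map θ t) k = ∑ i with (θ i).val < k, t i := by
  simp_rw [cumSum, simplex_map_apply]
  rw [← Finset.sum_fiberwise_of_maps_to (s := {i | (θ i).val < k})
    (t := Finset.univ.filter fun j ↦ j.val < k) (g := θ) (by simp)]
  refine Finset.sum_congr rfl fun j hj ↦ Finset.sum_congr ?_ fun _ _ ↦ rfl
  ext i
  simp only [Finset.mem_filter, Finset.mem_univ, true_and] at hj ⊢
  grind

lemma exists_block (t : stdSimplex ℝ (Fin (n + 1))) (x : Set.Ico (0 : ℝ) 1) :
    ∃ i : Fin (n + 1), cumSum t i ≤ x ∧ x < cumSum t (i + 1) := by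
  by_contra! h
  have key : ∀ k ≤ n + 1, cumSum t k ≤ x := by
    intro k
    induction k with
    | zero => intro _; rw [cumSum_zero]; exact x.2.1
    | succ k ih => intro hk; exact h ⟨k, hk⟩ (ih (by omega))
  have := key (n + 1) le_rfl
  rw [cumSum_last] at this
  exact absurd x.2.2 (not_lt.mpr this)

/-- The point `t` of the simplex divides `[0, 1)` into consecutive blocks of lengths `t i`;
`blockIdx t x` is the index of the block that contains `x`. -/
noncomputable def blockIdx (t : stdSimplex ℝ (Fin (n + 1))) (x : Set.Ico (0 : ℝ) 1) : Fin (n + 1) :=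
  (exists_block t x).choose

lemma cumSum_blockIdx_le (t : stdSimplex ℝ (Fin (n + 1))) (x : Set.Ico (0 : ℝ) 1) :
    cumSum t (blockIdx t x) ≤ x := (exists_block t x).choose_spec.1

lemma lt_cumSum_blockIdx (t : stdSimplex ℝ (Fin (n + 1))) (x : Set.Ico (0 : ℝ) 1) :
    x < cumSum t (blockIdx t x + 1) := (exists_block t x).choose_spec.2

lemma blockIdx_eq {t : stdSimplex ℝ (Fin (n + 1))} {x : Set.Ico (0 : ℝ) 1} {i : Fin (n + 1)}
    (h₁ : cumSum t i ≤ x) (h₂ : x < cumSum t (i + 1)) : blockIdx t x = i := by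
  have h₃ := cumSum_blockIdx_le t x
  have h₄ := lt_cumSum_blockIdx t x
  rcases lt_trichotomy (blockIdx t x) i with h | h | h
  · exact absurd (cumSum_mono t (show (blockIdx t x).val + 1 ≤ i.val from h)) (by linarith)
  · exact h
  · exact absurd (cumSum_mono t (show i.val + 1 ≤ (blockIdx t x).val from h)) (by linarith)

/-- A monotone map only merges neighbouring blocks and inserts empty ones, so it relabels blocks
without moving them. This is what makes step functions compatible with faces and degeneracies. -/
lemma blockIdx_map {θ : Fin (m + 1) → Fin (n + 1)} (hθ : Monotone θ)
    (t : stdSimplex ℝ (Fin (m + 1))) (x : Set.Ico (0 : ℝ) 1) :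
    blockIdx (stdSimplex.map θ t) x = θ (blockIdx t x) := by
  apply blockIdx_eq
  · refine le_trans ?_ (cumSum_blockIdx_le t x)
    rw [cumSum_map]
    refine Finset.sum_le_sum_of_subset_of_nonneg ?_ (fun i _ _ ↦ stdSimplex.zero_le t i)
    intro i
    simp only [Finset.mem_filter, Finset.mem_univ, true_and]
    exact fun h ↦ hθ.reflect_lt h
  · refine lt_of_lt_of_le (lt_cumSum_blockIdx t x) ?_
    rw [cumSum_map]
    refine Finset.sum_le_sum_of_subset_of_nonneg ?_ (fun i _ _ ↦ stdSimplex.zero_le t i)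
    intro i
    simp only [Finset.mem_filter, Finset.mem_univ, true_and, Nat.lt_succ_iff]
    exact fun h ↦ hθ h

/-- If `x` lies in an earlier block for one point than for the other, the right end of that earlier
block has crossed `x`. Hence the disagreement is confined to intervals swept by the block ends. -/
lemma exists_mem_uIcc_of_blockIdx_ne {t t' : stdSimplex ℝ (Fin (n + 1))} {x : Set.Ico (0 : ℝ) 1}
    (h : blockIdx t x ≠ blockIdx t' x) :
    ∃ k ∈ Finset.range (n + 2), (x : ℝ) ∈ Set.uIcc (cumSum t k) (cumSum t' k) := by
  have aux : ∀ {t t' : stdSimplex ℝ (Fin (n + 1))}, blockIdx t x < blockIdx t' x →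
      ∃ k ∈ Finset.range (n + 2), (x : ℝ) ∈ Set.Icc (cumSum t' k) (cumSum t k) := by
    intro t t' h
    refine ⟨blockIdx t x + 1, by simp; omega, ?_, (lt_cumSum_blockIdx t x).le⟩
    exact (cumSum_mono t' (show (blockIdx t x).val + 1 ≤ (blockIdx t' x).val from h)).trans
      (cumSum_blockIdx_le t' x)
  rcases lt_or_gt_of_ne h with h | h
  · obtain ⟨k, hk, hx⟩ := aux h
    exact ⟨k, hk, Set.Icc_subset_uIcc' hx⟩
  · obtain ⟨k, hk, hx⟩ := aux h
    exact ⟨k, hk, Set.Icc_subset_uIcc hx⟩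

end Blocks

/-! ### The space of step functions and its covering by translations -/

section StepSpace

open MeasureTheory

/-- The space of functions `[0, 1) → G`, two functions being close if they differ on a set of small
outer measure. -/
def StepSpace (G : Type u) : Type u := Set.Ico (0 : ℝ) 1 → G

namespace StepSpace

variable {G : Type u}

/-- The set where two functions differ. -/
def diffSet (f g : StepSpace G) : Set ℝ := Subtype.val '' {x | f x ≠ g x}

lemma volume_diffSet_ne_top (f g : StepSpace G) : volume (diffSet f g) ≠ ⊤ := by
  refine ne_top_of_le_ne_top ?_ (measure_mono (t := Set.Ico (0 : ℝ) 1) ?_)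
  · simp
  · rintro _ ⟨x, -, rfl⟩
    exact x.2

noncomputable instance : PseudoMetricSpace (StepSpace G) where
  dist f g := (volume (diffSet f g)).toReal
  dist_self f := by simp [diffSet]
  dist_comm f g := by simp only [diffSet, ne_comm]
  dist_triangle f g h := by
    rw [← ENNReal.toReal_add (volume_diffSet_ne_top f g) (volume_diffSet_ne_top g h)]
    refine ENNReal.toReal_mono
      (ENNReal.add_ne_top.mpr ⟨volume_diffSet_ne_top f g, volume_diffSet_ne_top g h⟩) ?_
    refine (measure_mono ?_).trans (measure_union_le _ _)
    rintro _ ⟨x, hx, rfl⟩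
    by_cases hfg : f x = g x
    · exact Or.inr ⟨x, fun hgh ↦ hx (hfg.trans hgh), rfl⟩
    · exact Or.inl ⟨x, hfg, rfl⟩

lemma dist_def (f g : StepSpace G) : dist f g = (volume (diffSet f g)).toReal := rfl

/-- The step function with value `a i` on the `i`-th block of `t`. -/
noncomputable def step {n : ℕ} (a : Fin (n + 1) → G) (t : stdSimplex ℝ (Fin (n + 1))) :
    StepSpace G := fun x ↦ a (blockIdx t x)

lemma dist_step_le {n : ℕ} (a : Fin (n + 1) → G) (t t' : stdSimplex ℝ (Fin (n + 1))) :
    dist (step a t) (step a t') ≤ ∑ k ∈ Finset.range (n + 2), |cumSum t' k - cumSum t k| := by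
  rw [dist_def]
  refine ENNReal.toReal_le_of_le_ofReal (Finset.sum_nonneg fun _ _ ↦ abs_nonneg _) ?_
  rw [ENNReal.ofReal_sum_of_nonneg fun _ _ ↦ abs_nonneg _]
  have hsub : diffSet (step a t) (step a t') ⊆
      ⋃ k ∈ Finset.range (n + 2), Set.uIcc (cumSum t k) (cumSum t' k) := by
    rintro _ ⟨x, hx, rfl⟩
    have : blockIdx t x ≠ blockIdx t' x := fun h ↦ hx (congrArg a h)
    obtain ⟨k, hk, hx⟩ := exists_mem_uIcc_of_blockIdx_ne this
    exact Set.mem_biUnion hk hx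
  refine (measure_mono hsub).trans ((measure_biUnion_finset_le _ _).trans ?_)
  refine Finset.sum_le_sum fun k _ ↦ ?_
  rw [Real.volume_interval]

lemma continuous_step {n : ℕ} (a : Fin (n + 1) → G) : Continuous (step a) := by
  rw [continuous_iff_continuousAt]
  intro t
  rw [ContinuousAt, tendsto_iff_dist_tendsto_zero]
  have hc : Continuous fun t' : stdSimplex ℝ (Fin (n + 1)) ↦
      ∑ k ∈ Finset.range (n + 2), |cumSum t k - cumSum t' k| :=
    continuous_finsetSum _ fun k _ ↦ (continuous_const.sub (continuous_cumSum k)).abs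
  refine squeeze_zero (fun _ ↦ dist_nonneg) (fun t' ↦ dist_step_le a t' t) ?_
  simpa using hc.tendsto t

variable [Group G]

instance : MulAction G (StepSpace G) where
  smul g f := fun x ↦ g * f x
  one_smul f := funext fun x ↦ one_mul (f x)
  mul_smul g h f := funext fun x ↦ mul_assoc g h (f x)

lemma smul_apply (g : G) (f : StepSpace G) (x : Set.Ico (0 : ℝ) 1) : (g • f) x = g * f x := rfl

lemma dist_smul_smul (g : G) (f f' : StepSpace G) : dist (g • f) (g • f') = dist f f' := by
  simp only [dist_def, diffSet, smul_apply, ne_eq, mul_right_inj]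

/-- A nontrivial translation changes the value at every point of `[0, 1)`. The uniform displacement
makes the action properly discontinuous. -/
lemma dist_smul_self {g : G} (hg : g ≠ 1) (f : StepSpace G) : dist (g • f) f = 1 := by
  have h : diffSet (g • f) f = Set.Ico 0 1 := by
    simp [diffSet, smul_apply, hg, Set.Ico_def]
  simp [dist_def, h]

/-- The quotient of the step space by the translations. -/
abbrev Orbits (G : Type u) [Group G] := MulAction.orbitRel.Quotient G (StepSpace G)

theorem isQuotientCoveringMap_mk :
    IsQuotientCoveringMap (Quotient.mk (MulAction.orbitRel G (StepSpace G))) G where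
  toIsQuotientMap := isQuotientMap_quotient_mk'
  continuous_const_smul g := by
    refine LipschitzWith.continuous (K := 1) (LipschitzWith.of_dist_le_mul fun f f' ↦ ?_)
    simp [dist_smul_smul]
  apply_eq_iff_mem_orbit := Quotient.eq''
  disjoint f := by
    -- Two points of a ball of radius `1 / 2` are at distance less than `1`, so no nontrivial
    -- translate of the ball meets it.
    refine ⟨Metric.ball f (1 / 2), Metric.ball_mem_nhds f (by norm_num), ?_⟩
    rintro g ⟨_, ⟨f', hf', rfl⟩, hf''⟩
    by_contra hg
    have h₁ : dist (g • f') f' = 1 := dist_smul_self hg f'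
    have h₂ := dist_triangle_right (g • f') f' f
    rw [Metric.mem_ball] at hf' hf''
    simp only [h₁] at h₂
    linarith

end StepSpace

end StepSpace

lemma blockIdx_vertex {n : ℕ} (i : Fin (n + 1)) (x : Set.Ico (0 : ℝ) 1) :
    blockIdx (stdSimplex.vertex i) x = i := by
  have h : cumSum (stdSimplex.vertex (S := ℝ) i) i = 0 := by
    refine Finset.sum_eq_zero fun j hj ↦ ?_
    simp only [Finset.mem_filter, Finset.mem_univ, true_and] at hj
    rw [stdSimplex.vertex_coe, Pi.single_eq_of_ne (by rintro rfl; exact lt_irrefl _ hj)]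
  apply blockIdx_eq
  · rw [h]; exact x.2.1
  · rw [cumSum_succ, h, stdSimplex.vertex_coe, Pi.single_eq_same, zero_add]; exact x.2.2

/-! ### Monodromy and lifts of edges -/

section Monodromy

variable {E Z : Type*} [TopologicalSpace E] [TopologicalSpace Z] {p : E → Z}

/-- The monodromy of a path is the end point of any of its lifts. -/
lemma IsCoveringMap.monodromy_mk_eq_of_lift (hp : IsCoveringMap p) {x y : Z} {γ : Path x y}
    {e : p ⁻¹' {x}} {e' : E} (Γ : Path e.1 e') (h : ∀ s, p (Γ s) = γ s) :
    (hp.monodromy (.mk γ) e).1 = e' := by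
  have he' : p e' = y := by rw [← Γ.target, h, γ.target]
  have := hp.monodromy_eq_of_map_eq (γ := .mk γ) (ex := e) (ey := ⟨e', he'⟩) (.mk Γ) (by
    refine Eq.trans ?_ (Path.Homotopic.Quotient.mk_cast γ e.2 he')
    exact congrArg Path.Homotopic.Quotient.mk (Path.ext (funext h)))
  exact congrArg Subtype.val this

end Monodromy

section EdgePath

variable {G : Type u} [Group G]

/-- The constant function. -/
def StepSpace.const (g : G) : StepSpace G := fun _ ↦ g

/-- The path of step functions with two blocks from the constant function `k` to the constant
function `a`. -/
noncomputable def StepSpace.edgePath (k a : G) :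
    Path (StepSpace.const k) (StepSpace.const a) where
  toFun s := StepSpace.step ![k, a] (stdSimplexHomeomorphUnitInterval.symm s)
  continuous_toFun := (StepSpace.continuous_step _).comp (Homeomorph.continuous _)
  source' := by
    rw [← stdSimplexHomeomorphUnitInterval_zero, Homeomorph.symm_apply_apply]
    funext x
    rw [StepSpace.step, blockIdx_vertex]
    rfl
  target' := by
    rw [← stdSimplexHomeomorphUnitInterval_one, Homeomorph.symm_apply_apply]
    funext x
    rw [StepSpace.step, blockIdx_vertex]
    rfl

/-- Left translation by `k` carries the values `1, a` to `k, k * a`: this lifts an edge of label `a`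
starting from any constant function. -/
lemma StepSpace.mk_edgePath (k a : G) (s : unitInterval) :
    Quotient.mk (MulAction.orbitRel G (StepSpace G)) (StepSpace.edgePath k (k * a) s) =
      Quotient.mk _ (StepSpace.step ![1, a] (stdSimplexHomeomorphUnitInterval.symm s)) := by
  refine Quotient.sound ⟨k, funext fun x ↦ ?_⟩
  have key : ∀ i : Fin 2, k * (![1, a] : Fin 2 → G) i = (![k, k * a] : Fin 2 → G) i := by
    intro i
    fin_cases i <;> simp
  exact key _

end EdgePath

/-! ### Group-valued functions on morphisms and the fundamental group -/

section Cocycle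

variable {D : Type u} [Category.{v} D] {G : Type (max u v)} [Group G]

variable (F : ∀ {A B : D}, (A ⟶ B) → G) (hid : ∀ A : D, F (𝟙 A) = 1)
  (hcomp : ∀ {A B B' : D} (f : A ⟶ B) (g : B ⟶ B'), F (f ≫ g) = F f * F g)

include hcomp in
/-- A multiplicative `G`-valued function on the morphisms of `D` classifies a map from `|D|` to the
orbit space of the step space. -/
lemma exists_cocycle_map : ∃ q : C(ClassifyingSpace D, StepSpace.Orbits G),
    ∀ (n : ℕ) (σ : ComposableArrows D n) (t : stdSimplex ℝ (Fin (n + 1))),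
      q (simplexMap (X := nerve D) σ t) =
        Quotient.mk _ (StepSpace.step (fun i ↦ F (σ.map (homOfLE (Fin.zero_le i)))) t) := by
  refine exists_realization_desc (X := nerve D) (StepSpace.Orbits G) (fun n (σ : ComposableArrows D n) ↦
    ⟨fun t ↦ Quotient.mk _ (StepSpace.step (fun i ↦ 
      F (σ.map (homOfLE (Fin.zero_le i)))) t),
      continuous_quotient_mk'.comp (StepSpace.continuous_step _)⟩) ?_
  intro n m θ (σ : ComposableArrows D n) t
  have hθ : Monotone θ := θ.toOrderHom.monotone
  -- The restricted simplex starts at position `θ 0` instead of `0`. All values change by the left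
  -- factor `F` of the arrow between these two positions, which the orbit forgets.
  refine Quotient.sound ((MulAction.orbitRel G (StepSpace G)).symm
    ⟨F (σ.map (homOfLE (Fin.zero_le (θ 0)))), funext fun x ↦ ?_⟩)
  change F _ * F (σ.map (homOfLE (hθ (Fin.zero_le (blockIdx t x))))) = F (σ.map (homOfLE _))
  rw [← hcomp, ← σ.map_comp]
  have key : ∀ {i j : Fin (n + 1)} (h : i = j), F (σ.map (homOfLE (Fin.zero_le i))) =
      F (σ.map (homOfLE (Fin.zero_le j))) := by rintro i _ rfl; rfl
  exact key (blockIdx_map hθ t x).symm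

include hid hcomp in
/-- A multiplicative `G`-valued function on the morphisms of `D` induces a homomorphism on the
fundamental group of the classifying space. -/
theorem exists_fundamentalGroup_hom (A : D) :
    ∃ ψ : FundamentalGroup (ClassifyingSpace D) (classPt A) →* Gᵐᵒᵖ,
      ∀ (B : D) (f g : A ⟶ B), ψ (FundamentalGroup.fromPath (.mk
        ((classPath f).trans (classPath g).symm))) = MulOpposite.op (F f * (F g)⁻¹) := by
  obtain ⟨q, hq⟩ := exists_cocycle_map F hcomp
  have hp := StepSpace.isQuotientCoveringMap_mk (G := G)
  have hq₁ : ∀ {B B' : D} (f : B ⟶ B') (s : unitInterval), q (classPath f s) = Quotient.mk _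
      (StepSpace.step ![1, F f] (stdSimplexHomeomorphUnitInterval.symm s)) := by
    intro B B' f s
    refine (hq 1 (ComposableArrows.mk₁ f) _).trans ?_
    congr 2
    funext i
    fin_cases i
    · exact hid B
    · rfl
  have he : Quotient.mk (MulAction.orbitRel G (StepSpace G)) (StepSpace.const 1) = q (classPt A) := by
    refine Eq.trans ?_ (hq 0 (ComposableArrows.mk₀ A) default).symm
    congr 1
    funext x
    change 1 = F ((ComposableArrows.mk₀ A).map _)
    rw [← hid A]
    congr 1
  let e : Quotient.mk (MulAction.orbitRel G (StepSpace G)) ⁻¹' {q (classPt A)} :=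
    ⟨StepSpace.const 1, he⟩
  refine ⟨(hp.fundamentalGroupToMulOpposite e).comp (FundamentalGroup.map q (classPt A)),
    fun B f g ↦ ?_⟩
  rw [MonoidHom.comp_apply, hp.fundamentalGroupToMulOpposite_apply_eq_Iff]
  symm
  have hΓ : F f * (F g)⁻¹ * F g = F f := by group
  -- The lift follows `f` from `1` to `F f`, then `g` backwards; the lift of `g` that ends at `F f`
  -- starts at `F f * (F g)⁻¹`.
  let Γ : Path (StepSpace.const 1) (StepSpace.const (F f * (F g)⁻¹)) :=
    (StepSpace.edgePath 1 (1 * F f)).trans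
      ((StepSpace.edgePath (F f * (F g)⁻¹) (F f * (F g)⁻¹ * F g)).symm.cast
        (by rw [hΓ, one_mul]) rfl)
  have hΓq : ∀ s, Quotient.mk (MulAction.orbitRel G (StepSpace G)) (Γ s) =
      ((classPath f).trans (classPath g).symm).map q.continuous s := by
    intro s
    rw [Path.map_coe, Function.comp_apply, Path.trans_apply, Path.trans_apply]
    split_ifs
    · rw [StepSpace.mk_edgePath, hq₁]
    · exact (StepSpace.mk_edgePath _ _ _).trans (hq₁ g _).symm
  refine (hp.isCoveringMap.monodromy_mk_eq_of_lift (e := e)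
    (γ := ((classPath f).trans (classPath g).symm).map q.continuous) Γ hΓq).trans ?_
  funext x
  exact (mul_one _).symm

end Cocycle

/-! ### Restricting a point of a simplex to a window -/

section Window

/-- A nondegenerate subinterval of `[0, 1]`. -/
structure Window where
  /-- the left end point -/
  lo : ℝ
  /-- the right end point -/
  hi : ℝ
  zero_le : 0 ≤ lo
  lt : lo < hi
  le_one : hi ≤ 1

namespace Window

variable (W : Window) {n m : ℕ}

/-- The retraction of the line onto the window. -/
noncomputable def clamp (x : ℝ) : ℝ := max W.lo (min W.hi x)

lemma clamp_mono : Monotone W.clamp := fun _ _ h ↦ max_le_max le_rfl (min_le_min le_rfl h)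

lemma continuous_clamp : Continuous W.clamp := by
  unfold clamp
  fun_prop

lemma clamp_of_le {x : ℝ} (h : x ≤ W.lo) : W.clamp x = W.lo :=
  max_eq_left ((min_le_right _ _).trans h)

lemma clamp_of_ge {x : ℝ} (h : W.hi ≤ x) : W.clamp x = W.hi := by
  rw [clamp, min_eq_left h, max_eq_right W.lt.le]

lemma sum_clamp_sub (t : stdSimplex ℝ (Fin (n + 1))) {k : ℕ} (hk : k ≤ n + 1) :
    ∑ i : Fin (n + 1) with i.val < k, (W.clamp (cumSum t (i + 1)) - W.clamp (cumSum t i)) =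
      W.clamp (cumSum t k) - W.lo := by
  induction k with
  | zero => simp [cumSum_zero, W.clamp_of_le W.zero_le]
  | succ k ih =>
    have h : (Finset.univ.filter fun i : Fin (n + 1) ↦ i.val < k + 1) =
        insert ⟨k, hk⟩ (Finset.univ.filter fun i : Fin (n + 1) ↦ i.val < k) := by
      ext j
      simp only [Finset.mem_filter, Finset.mem_univ, true_and, Finset.mem_insert, Fin.ext_iff]
      omega
    rw [h, Finset.sum_insert (by simp), ih (by omega)]
    ring

/-- The restriction of a point of the simplex, regarded as a division of `[0, 1)` into blocks, to a
window: the coordinates are the relative lengths of the intersections of the blocks with the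
window. -/
noncomputable def restrict (t : stdSimplex ℝ (Fin (n + 1))) : stdSimplex ℝ (Fin (n + 1)) :=
  ⟨fun i ↦ (W.clamp (cumSum t (i + 1)) - W.clamp (cumSum t i)) / (W.hi - W.lo), by
    refine ⟨fun i ↦ div_nonneg (sub_nonneg.mpr (W.clamp_mono (cumSum_mono t (Nat.le_succ _))))
      (sub_nonneg.mpr W.lt.le), ?_⟩
    have h := W.sum_clamp_sub t le_rfl
    rw [Finset.filter_true_of_mem (fun i _ ↦ i.isLt), cumSum_last, W.clamp_of_ge W.le_one] at h
    rw [← Finset.sum_div, h, div_self (sub_pos.mpr W.lt).ne']⟩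

lemma restrict_apply (t : stdSimplex ℝ (Fin (n + 1))) (i : Fin (n + 1)) : W.restrict t i =
    (W.clamp (cumSum t (i + 1)) - W.clamp (cumSum t i)) / (W.hi - W.lo) := rfl

lemma continuous_restrict : Continuous (W.restrict (n := n)) :=
  Continuous.subtype_mk (continuous_pi fun _ ↦ ((W.continuous_clamp.comp (continuous_cumSum _)).sub
    (W.continuous_clamp.comp (continuous_cumSum _))).div_const _) _

/-- Restriction depends only on the block ends, and merging neighbouring blocks adds the lengths of
their intersections with the window. -/
lemma restrict_map {θ : Fin (m + 1) → Fin (n + 1)} (hθ : Monotone θ)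
    (t : stdSimplex ℝ (Fin (m + 1))) :
    W.restrict (stdSimplex.map θ t) = stdSimplex.map θ (W.restrict t) := by
  have key : ∀ k : ℕ, ∑ i with (θ i).val < k,
      (W.clamp (cumSum t (i + 1)) - W.clamp (cumSum t i)) =
        W.clamp (cumSum (stdSimplex.map θ t) k) - W.lo := by
    intro k
    -- By monotonicity the indices with `θ i < k` form an initial segment, so the clamped lengths
    -- telescope.
    obtain ⟨p, hp, hpk⟩ : ∃ p ≤ m + 1, ∀ i : Fin (m + 1), (θ i).val < k ↔ i.val < p := by
      by_cases h : ∃ i : Fin (m + 1), k ≤ (θ i).val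
      · classical
        let i₀ := Finset.min' (Finset.univ.filter fun i ↦ k ≤ (θ i).val)
          (by obtain ⟨i, hi⟩ := h; exact ⟨i, by simpa using hi⟩)
        have h₀ : k ≤ (θ i₀).val := by
          simpa using Finset.min'_mem (Finset.univ.filter fun i ↦ k ≤ (θ i).val) _
        refine ⟨i₀, i₀.isLt.le, fun i ↦ ⟨fun hi ↦ ?_, fun hi ↦ ?_⟩⟩
        · by_contra! hc
          exact absurd (hθ (show i₀ ≤ i from hc)) (by rw [Fin.le_def]; omega)
        · by_contra! hc
          exact absurd (Finset.min'_le (Finset.univ.filter fun i ↦ k ≤ (θ i).val) i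
            (by simpa using hc)) (not_le.mpr hi)
      · push Not at h
        exact ⟨m + 1, le_rfl, fun i ↦ ⟨fun _ ↦ i.isLt, fun _ ↦ h i⟩⟩
    rw [cumSum_map]
    simp_rw [hpk]
    exact W.sum_clamp_sub t hp
  refine stdSimplex.ext (funext fun j ↦ ?_)
  rw [simplex_map_apply, restrict_apply]
  simp_rw [restrict_apply]
  rw [← Finset.sum_div]
  congr 1
  have h₁ := key (j + 1)
  have h₂ : (Finset.univ.filter fun i ↦ (θ i).val < j.val + 1) =
      (Finset.univ.filter fun i ↦ (θ i).val < j.val) ∪ (Finset.univ.filter fun i ↦ θ i = j) := by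
    ext i
    simp only [Finset.mem_filter, Finset.mem_univ, true_and, Finset.mem_union, Fin.ext_iff]
    omega
  rw [h₂, Finset.sum_union (by
    rw [Finset.disjoint_filter]
    rintro i - h rfl
    exact lt_irrefl _ h), key j] at h₁
  linarith

/-- Every point of the simplex is concentrated at one vertex within some window. -/
lemma exists_restrict_eq_one (t : stdSimplex ℝ (Fin (n + 1))) :
    ∃ (W : Window) (i : Fin (n + 1)), W.restrict t i = 1 := by
  obtain ⟨i, hi⟩ : ∃ i, 0 < t i := by
    by_contra! h
    have := stdSimplex.sum_eq_one t
    rw [Finset.sum_eq_zero fun i _ ↦ le_antisymm (h i) (stdSimplex.zero_le t i)] at this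
    exact zero_ne_one this
  have h₁ := cumSum_succ t i
  -- The window is the `i`-th block itself, nondegenerate because `t i` is positive.
  refine ⟨⟨cumSum t i, cumSum t (i + 1), ?_, by linarith, ?_⟩, i, ?_⟩
  · rw [← cumSum_zero t]
    exact cumSum_mono t (Nat.zero_le _)
  · rw [← cumSum_last t]
    exact cumSum_mono t i.isLt
  · rw [restrict_apply, clamp_of_le _ le_rfl, clamp_of_ge _ le_rfl]
    exact div_self (by simp only; linarith)

end Window

end Window

/-! ### The homotopy towards the heavy class -/

section Contraction

open Classical in
/-- The total weight of the class of `i` under the relation `r`. -/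
noncomputable def classMass {n : ℕ} (r : Fin (n + 1) → Fin (n + 1) → Prop)
    (t : stdSimplex ℝ (Fin (n + 1))) (i : Fin (n + 1)) : ℝ := ∑ j with r i j, t j

variable {n m : ℕ} {r : Fin (n + 1) → Fin (n + 1) → Prop}

lemma continuous_classMass (i : Fin (n + 1)) :
    Continuous fun t : stdSimplex ℝ (Fin (n + 1)) ↦ classMass r t i :=
  continuous_finsetSum _ fun i _ ↦ continuous_simplex_apply i

lemma classMass_map (θ : Fin (m + 1) → Fin (n + 1)) (t : stdSimplex ℝ (Fin (m + 1)))
    (i : Fin (n + 1)) {r' : Fin (m + 1) → Prop} [DecidablePred r'] (hr : ∀ j, r' j ↔ r i (θ j)) :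
    classMass r (stdSimplex.map θ t) i = ∑ j with r' j, t j := by
  classical
  simp_rw [classMass, simplex_map_apply]
  rw [← Finset.sum_fiberwise_of_maps_to (s := Finset.univ.filter r')
    (t := Finset.univ.filter fun j ↦ r i j) (g := θ) (by simp [hr])]
  refine Finset.sum_congr (by congr) fun j hj ↦ Finset.sum_congr ?_ fun _ _ ↦ rfl
  ext i
  simp only [Finset.mem_filter, Finset.mem_univ, true_and, hr] at hj ⊢
  grind

lemma classMass_congr (hr : Equivalence r) (t : stdSimplex ℝ (Fin (n + 1))) {i j : Fin (n + 1)}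
    (h : r i j) : classMass r t i = classMass r t j := by
  unfold classMass
  congr 1
  ext k
  simp only [Finset.mem_filter, Finset.mem_univ, true_and]
  exact ⟨hr.trans (hr.symm h), hr.trans h⟩

/-- Distinct classes are disjoint and the total mass is `1`. Hence at most one class can weigh more
than `1 / 2`, and "the heavy class" makes sense. -/
lemma classMass_add_le (hr : Equivalence r) (t : stdSimplex ℝ (Fin (n + 1))) {i j : Fin (n + 1)}
    (h : ¬ r i j) : classMass r t i + classMass r t j ≤ 1 := by
  classical
  unfold classMass
  rw [← Finset.sum_union (by
    rw [Finset.disjoint_filter]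
    exact fun k _ h₁ h₂ ↦ h (hr.trans h₁ (hr.symm h₂))), ← stdSimplex.sum_eq_one t]
  exact Finset.sum_le_sum_of_subset_of_nonneg (Finset.subset_univ _)
    fun i _ _ ↦ stdSimplex.zero_le t i

/-- A cut-off function, `0` up to `1 / 2` and `1` from `3 / 4` on. -/
noncomputable def cutoff (x : ℝ) : ℝ := max 0 (min 1 (4 * x - 2))

lemma cutoff_nonneg (x : ℝ) : 0 ≤ cutoff x := le_max_left _ _

lemma cutoff_le_one (x : ℝ) : cutoff x ≤ 1 := max_le zero_le_one (min_le_left _ _)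

lemma cutoff_of_le {x : ℝ} (h : x ≤ 1 / 2) : cutoff x = 0 :=
  max_eq_left ((min_le_right _ _).trans (by linarith))

lemma cutoff_of_ge {x : ℝ} (h : 3 / 4 ≤ x) : cutoff x = 1 := by
  rw [cutoff, min_eq_left (by linarith), max_eq_right zero_le_one]

variable (r) in
/-- The part of `t` that lies in the class whose weight exceeds `1 / 2`, if there is one, rescaled
to the total weight `cutoff` of that weight. -/
noncomputable def heavyPart (t : stdSimplex ℝ (Fin (n + 1))) (i : Fin (n + 1)) : ℝ :=
  cutoff (classMass r t i) / max (classMass r t i) (1 / 2) * t i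

/-- Where `cutoff` is nonzero the mass exceeds `1 / 2`, so the maximum never alters the value; it
only keeps the denominator away from `0`. -/
lemma continuous_heavyPart (i : Fin (n + 1)) :
    Continuous fun t : stdSimplex ℝ (Fin (n + 1)) ↦ heavyPart r t i := by
  have h : Continuous cutoff := by unfold cutoff; fun_prop
  refine Continuous.mul (Continuous.div (h.comp (continuous_classMass i))
    ((continuous_classMass i).max continuous_const) fun t ↦ ?_) (continuous_simplex_apply i)
  exact (lt_of_lt_of_le (by norm_num) (le_max_right _ _)).ne'

lemma heavyPart_nonneg (t : stdSimplex ℝ (Fin (n + 1))) (i : Fin (n + 1)) : 0 ≤ heavyPart r t i :=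
  mul_nonneg (div_nonneg (cutoff_nonneg _) (le_max_of_le_right (by norm_num)))
    (stdSimplex.zero_le t i)

lemma heavyPart_of_not (hr : Equivalence r) (t : stdSimplex ℝ (Fin (n + 1))) {i j : Fin (n + 1)}
    (hi : 1 / 2 < classMass r t i) (h : ¬ r i j) : heavyPart r t j = 0 := by
  have := classMass_add_le hr t h
  rw [heavyPart, cutoff_of_le (by linarith), zero_div, zero_mul]

lemma sum_heavyPart_of_lt (hr : Equivalence r) (t : stdSimplex ℝ (Fin (n + 1))) {i : Fin (n + 1)}
    (hi : 1 / 2 < classMass r t i) : ∑ j, heavyPart r t j = cutoff (classMass r t i) := by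
  classical
  have h₁ : ∑ j, heavyPart r t j = ∑ j with r i j, heavyPart r t j := by
    refine (Finset.sum_subset (Finset.subset_univ _) fun j _ hj ↦ ?_).symm
    exact heavyPart_of_not hr t hi (by simpa using hj)
  have h₂ : ∑ j with r i j, heavyPart r t j =
      ∑ j with r i j, cutoff (classMass r t i) / classMass r t i * t j := by
    refine Finset.sum_congr rfl fun j hj ↦ ?_
    rw [heavyPart, ← classMass_congr hr t (by simpa using hj), max_eq_left hi.le]
  have h₃ : ∑ j with r i j, t j = classMass r t i := by
    unfold classMass
    congr!
  rw [h₁, h₂, ← Finset.mul_sum, h₃, div_mul_cancel₀ _ (by linarith)]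

lemma sum_heavyPart_le_one (hr : Equivalence r) (t : stdSimplex ℝ (Fin (n + 1))) :
    ∑ j, heavyPart r t j ≤ 1 := by
  by_cases h : ∃ i, 1 / 2 < classMass r t i
  · obtain ⟨i, hi⟩ := h
    rw [sum_heavyPart_of_lt hr t hi]
    exact cutoff_le_one _
  · push Not at h
    rw [Finset.sum_eq_zero fun j _ ↦ by rw [heavyPart, cutoff_of_le (h j), zero_div, zero_mul]]
    exact zero_le_one

lemma sum_heavyPart_nonneg (t : stdSimplex ℝ (Fin (n + 1))) : 0 ≤ ∑ j, heavyPart r t j :=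
  Finset.sum_nonneg fun j _ ↦ heavyPart_nonneg t j

/-- The homotopy that moves a point of the simplex linearly towards the heavy class of its
restriction to a window. -/
noncomputable def contract (W : Window) (hr : Equivalence r) (s : unitInterval)
    (t : stdSimplex ℝ (Fin (n + 1))) : stdSimplex ℝ (Fin (n + 1)) :=
  ⟨fun i ↦ (1 - s * ∑ j, heavyPart r (W.restrict t) j) * t i + s * heavyPart r (W.restrict t) i, by
    refine ⟨fun i ↦ add_nonneg (mul_nonneg (sub_nonneg.mpr ?_) (stdSimplex.zero_le t i))
      (mul_nonneg s.2.1 (heavyPart_nonneg _ i)), ?_⟩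
    · exact mul_le_one₀ s.2.2 (sum_heavyPart_nonneg _) (sum_heavyPart_le_one hr _)
    · rw [Finset.sum_add_distrib, ← Finset.mul_sum, ← Finset.mul_sum, stdSimplex.sum_eq_one]
      ring⟩

lemma contract_apply (W : Window) (hr : Equivalence r) (s : unitInterval)
    (t : stdSimplex ℝ (Fin (n + 1))) (i : Fin (n + 1)) : contract W hr s t i =
      (1 - s * ∑ j, heavyPart r (W.restrict t) j) * t i + s * heavyPart r (W.restrict t) i := rfl

lemma continuous_contract (W : Window) (hr : Equivalence r) :
    Continuous fun x : stdSimplex ℝ (Fin (n + 1)) × unitInterval ↦ contract W hr x.2 x.1 := by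
  have h : ∀ i, Continuous fun x : stdSimplex ℝ (Fin (n + 1)) × unitInterval ↦
      heavyPart r (W.restrict x.1) i := fun i ↦
    (continuous_heavyPart i).comp (W.continuous_restrict.comp continuous_fst)
  have hs : Continuous fun x : stdSimplex ℝ (Fin (n + 1)) × unitInterval ↦ (x.2 : ℝ) :=
    continuous_subtype_val.comp continuous_snd
  refine Continuous.subtype_mk (continuous_pi fun i ↦ ?_) _
  exact ((continuous_const.sub (hs.mul (continuous_finsetSum _ fun j _ ↦ h j))).mul
    ((continuous_simplex_apply i).comp continuous_fst)).add (hs.mul (h i))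

lemma contract_zero (W : Window) (hr : Equivalence r) (t : stdSimplex ℝ (Fin (n + 1))) :
    contract W hr 0 t = t := by
  refine stdSimplex.ext (funext fun i ↦ ?_)
  simp [contract_apply]

/-- Above mass `3 / 4` the cut-off equals `1`: at time `1` the coefficient of `t` is `0`, and what
remains is supported in the heavy class. -/
lemma contract_one_apply (W : Window) (hr : Equivalence r) {t : stdSimplex ℝ (Fin (n + 1))}
    {i j : Fin (n + 1)} (hi : 3 / 4 < classMass r (W.restrict t) i)
    (hj : contract W hr 1 t j ≠ 0) : r i j := by
  by_contra h
  apply hj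
  rw [contract_apply, sum_heavyPart_of_lt hr _ (by linarith : 1 / 2 < classMass r _ i),
    cutoff_of_ge hi.le, heavyPart_of_not hr _ (by linarith : 1 / 2 < classMass r _ i) h]
  simp

lemma heavyPart_map {θ : Fin (m + 1) → Fin (n + 1)} {r' : Fin (m + 1) → Fin (m + 1) → Prop}
    (h : ∀ i j, r' i j ↔ r (θ i) (θ j)) (t : stdSimplex ℝ (Fin (m + 1))) (j : Fin (n + 1)) :
    heavyPart r (stdSimplex.map θ t) j = ∑ i with θ i = j, heavyPart r' t i := by
  classical
  have hm : ∀ i, θ i = j → classMass r' t i = classMass r (stdSimplex.map θ t) j := by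
    rintro i rfl
    exact (classMass_map θ t (θ i) (r' := r' i) (h i)).symm
  rw [heavyPart, simplex_map_apply, Finset.mul_sum]
  refine Finset.sum_congr rfl fun i hi ↦ ?_
  rw [heavyPart, hm i (by simpa using hi)]

lemma contract_map (W : Window) {θ : Fin (m + 1) → Fin (n + 1)} (hθ : Monotone θ)
    {r' : Fin (m + 1) → Fin (m + 1) → Prop} (hr : Equivalence r) (hr' : Equivalence r')
    (h : ∀ i j, r' i j ↔ r (θ i) (θ j)) (s : unitInterval) (t : stdSimplex ℝ (Fin (m + 1))) :
    stdSimplex.map θ (contract W hr' s t) = contract W hr s (stdSimplex.map θ t) := by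
  refine stdSimplex.ext (funext fun j ↦ ?_)
  have hsum : ∑ j, heavyPart r (stdSimplex.map θ (W.restrict t)) j =
      ∑ i, heavyPart r' (W.restrict t) i := by
    simp_rw [heavyPart_map h]
    exact Finset.sum_fiberwise _ θ _
  rw [simplex_map_apply, contract_apply, W.restrict_map hθ, hsum, heavyPart_map h,
    simplex_map_apply]
  simp_rw [contract_apply]
  rw [Finset.sum_add_distrib, ← Finset.mul_sum, ← Finset.mul_sum]

end Contraction

/-! ### Paths around a square -/

section Square

open unitInterval

variable {Y : Type*} [TopologicalSpace Y]

/-- The two boundary paths of a square between opposite corners are homotopic. -/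
lemma homotopic_of_square (H : C(I × I, Y)) {a b c d : Y} (p : Path a b) (q : Path b d)
    (p' : Path a c) (q' : Path c d) (hp : ∀ s, p s = H (s, 0)) (hq : ∀ s, q s = H (1, s))
    (hp' : ∀ s, p' s = H (0, s)) (hq' : ∀ s, q' s = H (s, 1)) :
    (p.trans q).Homotopic (p'.trans q') := by
  obtain rfl : H (0, 0) = a := by rw [← hp, p.source]
  obtain rfl : H (1, 0) = b := by rw [← hp, p.target]
  obtain rfl : H (0, 1) = c := by rw [← hq', q'.source]
  obtain rfl : H (1, 1) = d := by rw [← hq', q'.target]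
  let P : Path ((0, 0) : I × I) (1, 0) := ⟨⟨fun s ↦ (s, 0), by fun_prop⟩, rfl, rfl⟩
  let Q : Path ((1, 0) : I × I) (1, 1) := ⟨⟨fun s ↦ (1, s), by fun_prop⟩, rfl, rfl⟩
  let P' : Path ((0, 0) : I × I) (0, 1) := ⟨⟨fun s ↦ (0, s), by fun_prop⟩, rfl, rfl⟩
  let Q' : Path ((0, 1) : I × I) (1, 1) := ⟨⟨fun s ↦ (s, 1), by fun_prop⟩, rfl, rfl⟩
  have e₁ : p = P.map H.continuous := Path.ext (funext hp)
  have e₂ : q = Q.map H.continuous := Path.ext (funext hq)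
  have e₃ : p' = P'.map H.continuous := Path.ext (funext hp')
  have e₄ : q' = Q'.map H.continuous := Path.ext (funext hq')
  have : ContractibleSpace I := (convex_Icc (0 : ℝ) 1).contractibleSpace ⟨0, by simp⟩
  rw [e₁, e₂, e₃, e₄, ← Path.map_trans, ← Path.map_trans]
  exact (SimplyConnectedSpace.paths_homotopic (P.trans Q) (P'.trans Q')).map H

end Square

/-! ### Paths inside a simplex and functoriality of edges -/

section SimplexPaths

variable {D : Type u} [Category.{v} D] {n m : ℕ}

instance : ContractibleSpace (stdSimplex ℝ (Fin (n + 1))) :=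
  (convex_stdSimplex ℝ (Fin (n + 1))).contractibleSpace
    ⟨_, (stdSimplex.vertex (S := ℝ) (0 : Fin (n + 1))).2⟩

lemma simplexMap_vertex (σ : ComposableArrows D n) (i : Fin (n + 1)) :
    simplexMap (X := nerve D) σ (stdSimplex.vertex i) = classPt (σ.obj i) := by
  let θ : ⦋0⦌ ⟶ ⦋n⦌ := SimplexCategory.const _ _ i
  have h₁ : (nerve D).map θ.op σ = ComposableArrows.mk₀ (σ.obj i) := ComposableArrows.ext₀ rfl
  have h₂ := simplexMap_map (X := nerve D) θ σ (stdSimplex.vertex 0)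
  rw [h₁, stdSimplex.map_vertex] at h₂
  refine h₂.symm.trans ?_
  exact congrArg (simplexMap (X := nerve D) (n := 0) (ComposableArrows.mk₀ (σ.obj i)))
    (Subsingleton.elim _ _)

/-- The homotopy class of the image of any path in the simplex from `t` to the `i`-th vertex. -/
noncomputable def vertexClass (σ : ComposableArrows D n) (t : stdSimplex ℝ (Fin (n + 1)))
    (i : Fin (n + 1)) :
    Path.Homotopic.Quotient (simplexMap (X := nerve D) σ t) (classPt (σ.obj i)) :=
  .mk (((PathConnectedSpace.somePath t (stdSimplex.vertex i)).map
    (simplexMap (X := nerve D) σ).continuous).cast rfl (simplexMap_vertex σ i).symm)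

lemma vertexClass_eq (σ : ComposableArrows D n) (t : stdSimplex ℝ (Fin (n + 1)))
    (i : Fin (n + 1)) (γ : Path t (stdSimplex.vertex i)) :
    vertexClass σ t i = .mk ((γ.map (simplexMap (X := nerve D) σ).continuous).cast rfl
      (simplexMap_vertex σ i).symm) := by
  refine Path.Homotopic.Quotient.eq.mpr (Path.Homotopic.pathCast ?_ _ _)
  exact (SimplyConnectedSpace.paths_homotopic _ _).map _

/-- The path along an edge of a simplex. -/
lemma exists_path_edge (σ : ComposableArrows D n) {i j : Fin (n + 1)} (h : i ≤ j) :
    ∃ γ : Path (stdSimplex.vertex (S := ℝ) i) (stdSimplex.vertex j),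
      ∀ s, simplexMap (X := nerve D) σ (γ s) = classPath (σ.map (homOfLE h)) s := by
  let θ : ⦋1⦌ ⟶ ⦋n⦌ := SimplexCategory.mkOfLe i j h
  have h₀ : stdSimplexHomeomorphUnitInterval.symm 0 = stdSimplex.vertex 0 := by
    rw [← stdSimplexHomeomorphUnitInterval_zero, Homeomorph.symm_apply_apply]
  have h₁ : stdSimplexHomeomorphUnitInterval.symm 1 = stdSimplex.vertex 1 := by
    rw [← stdSimplexHomeomorphUnitInterval_one, Homeomorph.symm_apply_apply]
  refine ⟨⟨⟨fun s ↦ stdSimplex.map θ (stdSimplexHomeomorphUnitInterval.symm s),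
    (stdSimplex.continuous_map _).comp (Homeomorph.continuous _)⟩, ?_, ?_⟩, fun s ↦ ?_⟩
  · change stdSimplex.map θ (stdSimplexHomeomorphUnitInterval.symm 0) = _
    rw [h₀, stdSimplex.map_vertex]
    rfl
  · change stdSimplex.map θ (stdSimplexHomeomorphUnitInterval.symm 1) = _
    rw [h₁, stdSimplex.map_vertex]
    rfl
  · have h₂ : (nerve D).map θ.op σ = ComposableArrows.mk₁ (σ.map (homOfLE h)) :=
      ComposableArrows.ext₁ rfl rfl
        (((Category.id_comp _).trans (Category.comp_id (σ.map (homOfLE h)))).symm)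
    refine (simplexMap_map (X := nerve D) θ σ _).symm.trans ?_
    rw [h₂]
    rfl

/-- A simplex is simply connected, so any path to vertex `i` followed by the edge from `i` to `j`
represents the class for `j`. -/
lemma vertexClass_trans_edge (σ : ComposableArrows D n) (t : stdSimplex ℝ (Fin (n + 1)))
    {i j : Fin (n + 1)} (h : i ≤ j) :
    (vertexClass σ t i).trans (.mk (classPath (σ.map (homOfLE h)))) = vertexClass σ t j := by
  obtain ⟨γ, hγ⟩ := exists_path_edge σ h
  let γ₀ := PathConnectedSpace.somePath t (stdSimplex.vertex (S := ℝ) i)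
  rw [vertexClass_eq σ t i γ₀, vertexClass_eq σ t j (γ₀.trans γ),
    ← Path.Homotopic.Quotient.mk_trans]
  congr 1
  ext s
  rw [Path.cast_coe, Path.map_coe, Function.comp_apply, Path.trans_apply, Path.trans_apply]
  split_ifs
  · rfl
  · exact (hγ _).symm

/-- The edges of the classifying space are functorial up to homotopy. -/
theorem mk_classPath_comp {A B B' : D} (f : A ⟶ B) (g : B ⟶ B') :
    Path.Homotopic.Quotient.mk (classPath (f ≫ g)) =
      (Path.Homotopic.Quotient.mk (classPath f)).trans (.mk (classPath g)) := by
  let σ := ComposableArrows.mk₂ f g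
  have h₁ := vertexClass_trans_edge σ (stdSimplex.vertex 0) (show (0 : Fin 3) ≤ 1 by decide)
  have h₂ := vertexClass_trans_edge σ (stdSimplex.vertex 0) (show (1 : Fin 3) ≤ 2 by decide)
  have h₃ := vertexClass_trans_edge σ (stdSimplex.vertex 0) (show (0 : Fin 3) ≤ 2 by decide)
  rw [← h₁, ← h₃, Path.Homotopic.Quotient.trans_assoc] at h₂
  have h₄ := congrArg (fun γ ↦ (vertexClass σ (stdSimplex.vertex 0) 0).symm.trans γ) h₂
  simp only [← Path.Homotopic.Quotient.trans_assoc, Path.Homotopic.Quotient.symm_trans,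
    Path.Homotopic.Quotient.refl_trans] at h₄
  exact h₄.symm

end SimplexPaths

/-! ### Positions of a chain joined by identities -/

section IdRel

variable {D : Type u} [Category.{v} D] {n m : ℕ}

/-- The morphism of the chain `σ` from position `i` to position `j` is an identity. -/
def IsIdMap (σ : ComposableArrows D n) {i j : Fin (n + 1)} (h : i ≤ j) : Prop :=
  ∃ e : σ.obj i = σ.obj j, σ.map (homOfLE h) = eqToHom e

lemma isIdMap_of_eq (σ : ComposableArrows D n) {i j : Fin (n + 1)} (h : i ≤ j) (e : i = j) :
    IsIdMap σ h := by
  subst e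
  exact ⟨rfl, σ.map_id _⟩

lemma map_homOfLE_comp (σ : ComposableArrows D n) {i j k : Fin (n + 1)} (h : i ≤ j) (h' : j ≤ k) :
    σ.map (homOfLE (h.trans h')) = σ.map (homOfLE h) ≫ σ.map (homOfLE h') := by
  rw [← σ.map_comp, homOfLE_comp]

lemma IsIdMap.trans {σ : ComposableArrows D n} {i j k : Fin (n + 1)} {h : i ≤ j} {h' : j ≤ k}
    (H : IsIdMap σ h) (H' : IsIdMap σ h') : IsIdMap σ (h.trans h') := by
  obtain ⟨e, he⟩ := H
  obtain ⟨e', he'⟩ := H'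
  exact ⟨e.trans e', by rw [map_homOfLE_comp σ h h', he, he', eqToHom_trans]⟩

lemma IsIdMap.of_trans_left {σ : ComposableArrows D n} {i j k : Fin (n + 1)} {h : i ≤ j}
    {h' : j ≤ k} (H : IsIdMap σ h) (H' : IsIdMap σ (h.trans h')) : IsIdMap σ h' := by
  obtain ⟨e, he⟩ := H
  obtain ⟨e', he'⟩ := H'
  refine ⟨e.symm.trans e', ?_⟩
  rw [map_homOfLE_comp σ h h', he] at he'
  rw [← cancel_epi (eqToHom e), he', eqToHom_trans]

lemma IsIdMap.of_trans_right {σ : ComposableArrows D n} {i j k : Fin (n + 1)} {h : i ≤ j}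
    {h' : j ≤ k} (H : IsIdMap σ h') (H' : IsIdMap σ (h.trans h')) : IsIdMap σ h := by
  obtain ⟨e, he⟩ := H
  obtain ⟨e', he'⟩ := H'
  refine ⟨e'.trans e.symm, ?_⟩
  rw [map_homOfLE_comp σ h h', he] at he'
  rw [← cancel_mono (eqToHom e), he', eqToHom_trans]

/-- Two positions of a chain are related if the morphism between them is an identity. -/
def IdRel (σ : ComposableArrows D n) (i j : Fin (n + 1)) : Prop :=
  (∃ h : i ≤ j, IsIdMap σ h) ∨ (∃ h : j ≤ i, IsIdMap σ h)

lemma IdRel.isIdMap {σ : ComposableArrows D n} {i j : Fin (n + 1)} (H : IdRel σ i j) (h : i ≤ j) :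
    IsIdMap σ h := by
  rcases H with ⟨_, H⟩ | ⟨h', H⟩
  · exact H
  · exact isIdMap_of_eq σ h (le_antisymm h h')

lemma IdRel.symm {σ : ComposableArrows D n} {i j : Fin (n + 1)} (H : IdRel σ i j) : IdRel σ j i :=
  Or.symm H

lemma IdRel.obj_eq {σ : ComposableArrows D n} {i j : Fin (n + 1)} (H : IdRel σ i j) :
    σ.obj i = σ.obj j := by
  rcases H with ⟨_, e, _⟩ | ⟨_, e, _⟩
  · exact e
  · exact e.symm

/-- Identities satisfy two-out-of-three. Since the relation ignores order, transitivity uses all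
three forms, according to the arrangement of `i`, `j`, `k`. -/
lemma idRel_equivalence (σ : ComposableArrows D n) : _root_.Equivalence (IdRel σ) where
  refl i := Or.inl ⟨le_rfl, isIdMap_of_eq σ _ rfl⟩
  symm := IdRel.symm
  trans {i j k} H H' := by
    rcases le_total i j with h₁ | h₁ <;> rcases le_total j k with h₂ | h₂ <;>
      rcases le_total i k with h₃ | h₃
    · exact Or.inl ⟨_, (H.isIdMap h₁).trans (H'.isIdMap h₂)⟩
    · exact Or.inl ⟨h₁.trans h₂, (H.isIdMap h₁).trans (H'.isIdMap h₂)⟩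
    · exact Or.inl ⟨h₃, (H'.symm.isIdMap h₂).of_trans_right (h := h₃) (H.isIdMap h₁)⟩
    · exact Or.inr ⟨h₃, (H.isIdMap h₁).of_trans_right (h := h₃) (H'.symm.isIdMap h₂)⟩
    · exact Or.inl ⟨h₃, (H.symm.isIdMap h₁).of_trans_left (h' := h₃) (H'.isIdMap h₂)⟩
    · exact Or.inr ⟨h₃, (H'.isIdMap h₂).of_trans_left (h' := h₃) (H.symm.isIdMap h₁)⟩
    · exact Or.inr ⟨h₂.trans h₁, (H'.symm.isIdMap h₂).trans (H.symm.isIdMap h₁)⟩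
    · exact Or.inr ⟨_, (H'.symm.isIdMap h₂).trans (H.symm.isIdMap h₁)⟩

lemma idRel_map (θ : ⦋m⦌ ⟶ ⦋n⦌) (σ : ComposableArrows D n) (i j : Fin (m + 1)) :
    IdRel (n := m) ((nerve D).map θ.op σ : (nerve D) _⦋m⦌) i j ↔ IdRel σ (θ i) (θ j) := by
  have hθ : Monotone θ := θ.toOrderHom.monotone
  constructor
  · rintro (⟨h, H⟩ | ⟨h, H⟩)
    · exact Or.inl ⟨hθ h, H⟩
    · exact Or.inr ⟨hθ h, H⟩
  · intro H
    rcases le_total i j with h | h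
    · exact Or.inl ⟨h, H.isIdMap (hθ h)⟩
    · exact Or.inr ⟨h, H.symm.isIdMap (hθ h)⟩

/-- A point of a simplex that is supported on positions related by identities is mapped to the
corresponding vertex of the classifying space. -/
lemma simplexMap_eq_classPt (σ : ComposableArrows D n) (t : stdSimplex ℝ (Fin (n + 1)))
    (i : Fin (n + 1)) (h : ∀ j, t j ≠ 0 → IdRel σ i j) :
    simplexMap (X := nerve D) σ t = classPt (σ.obj i) := by
  classical
  let J : Finset (Fin (n + 1)) := Finset.univ.filter fun j ↦ IdRel σ i j
  have hi : i ∈ J := by simpa [J] using (idRel_equivalence σ).refl i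
  obtain ⟨m, hm⟩ : ∃ m, J.card = m + 1 :=
    ⟨J.card - 1, (Nat.sub_add_cancel (Finset.card_pos.mpr ⟨i, hi⟩)).symm⟩
  let θ' : Fin (m + 1) ↪o Fin (n + 1) := J.orderEmbOfFin hm
  have hθ'J : ∀ k, IdRel σ i (θ' k) := fun k ↦
    (Finset.mem_filter.mp (Finset.orderEmbOfFin_mem J hm k)).2
  have hrange : ∀ j, t j ≠ 0 → ∃ k, θ' k = j := by
    intro j hj
    have : j ∈ Set.range (J.orderEmbOfFin hm) := by
      rw [Finset.range_orderEmbOfFin]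
      simpa [J] using h j hj
    exact this
  let θ : ⦋m⦌ ⟶ ⦋n⦌ := SimplexCategory.mkHom θ'.toOrderHom
  have hfib : ∀ j (k : Fin (m + 1)), θ' k = j →
      ∑ k with θ' k = j, t (θ' k) = t j := by
    rintro j k rfl
    rw [Finset.sum_eq_single k]
    · intro l hl hlk
      exact absurd (θ'.injective (by simpa using hl)) hlk
    · simp
  let t' : stdSimplex ℝ (Fin (m + 1)) := ⟨fun k ↦ t (θ' k), fun k ↦ stdSimplex.zero_le t _, by
    rw [← stdSimplex.sum_eq_one t, ← Finset.sum_fiberwise Finset.univ θ']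
    refine Finset.sum_congr rfl fun j _ ↦ ?_
    by_cases hj : t j = 0
    · rw [hj]
      exact Finset.sum_eq_zero fun k hk ↦ by rw [(Finset.mem_filter.mp hk).2, hj]
    · obtain ⟨k, hk⟩ := hrange j hj
      exact hfib j k hk⟩
  have ht : stdSimplex.map θ t' = t := by
    refine stdSimplex.ext (funext fun j ↦ ?_)
    rw [simplex_map_apply]
    change ∑ k with θ' k = j, t (θ' k) = t j
    by_cases hj : t j = 0
    · rw [hj]
      exact Finset.sum_eq_zero fun k hk ↦ by rw [(Finset.mem_filter.mp hk).2, hj]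
    · obtain ⟨k, hk⟩ := hrange j hj
      exact hfib j k hk
  let z : ⦋m⦌ ⟶ ⦋0⦌ := SimplexCategory.const _ _ 0
  -- All arrows of the face spanned by the class of `i` are identities, so this face is a degeneracy
  -- of a vertex.
  have hdeg : (nerve D).map θ.op σ = (nerve D).map z.op (ComposableArrows.mk₀ (σ.obj i)) := by
    refine CategoryTheory.Functor.ext (fun k ↦ (hθ'J k).obj_eq.symm) fun k l f ↦ ?_
    obtain ⟨e, he⟩ := ((idRel_equivalence σ).trans (hθ'J k).symm (hθ'J l)).isIdMap
      (θ'.monotone (leOfHom f))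
    refine he.trans (Eq.trans ?_ (congrArg (eqToHom _ ≫ ·) (Category.id_comp _)).symm)
    exact (eqToHom_trans _ _).symm
  rw [← ht, ← simplexMap_map (X := nerve D) θ σ t', hdeg,
    simplexMap_map (X := nerve D) z (ComposableArrows.mk₀ (σ.obj i)) t']
  exact congrArg (simplexMap (X := nerve D) (n := 0) (ComposableArrows.mk₀ (σ.obj i)))
    (Subsingleton.elim _ _)

end IdRel

/-! ### The contraction and the open cover on the classifying space -/

section Cover

variable {D : Type u} [Category.{v} D]

/-- The contraction along a window, on the classifying space. -/
theorem exists_contraction (W : Window) :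
    ∃ K : C(ClassifyingSpace D, C(unitInterval, ClassifyingSpace D)),
      ∀ (n : ℕ) (σ : ComposableArrows D n) (t : stdSimplex ℝ (Fin (n + 1))) (s : unitInterval),
        K (simplexMap (X := nerve D) σ t) s =
          simplexMap (X := nerve D) σ (contract W (idRel_equivalence σ) s t) := by
  -- The homotopy is curried into the space of maps from the interval, so that it can be glued
  -- simplex by simplex on `|D|` itself rather than on `|D| × I`.
  obtain ⟨K, hK⟩ := exists_realization_desc (X := nerve D)
    C(unitInterval, ClassifyingSpace D) (fun n (σ : ComposableArrows D n) ↦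
      ContinuousMap.curry ⟨fun x ↦ simplexMap (X := nerve D) σ
        (contract W (idRel_equivalence σ) x.2 x.1),
        (simplexMap (X := nerve D) σ).continuous.comp (continuous_contract W _)⟩) (by
    intro n m θ (σ : ComposableArrows D n) t
    ext s
    refine (simplexMap_map (X := nerve D) θ σ _).trans ?_
    exact congrArg (simplexMap (X := nerve D) σ) (contract_map W θ.toOrderHom.monotone
      (idRel_equivalence σ) (idRel_equivalence _) (idRel_map θ σ) s t))
  exact ⟨K, fun n σ t s ↦ DFunLike.congr_fun (hK n σ t) s⟩

/-- The open set of the points of the classifying space that, within a window, are concentrated on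
identities of the object `A`. -/
theorem exists_heavy_open (W : Window) (A : D) : ∃ U : Set (ClassifyingSpace D), IsOpen U ∧
    ∀ (n : ℕ) (σ : ComposableArrows D n) (t : stdSimplex ℝ (Fin (n + 1))),
      simplexMap (X := nerve D) σ t ∈ U ↔
        ∃ i, σ.obj i = A ∧ 3 / 4 < classMass (IdRel σ) (W.restrict t) i := by
  -- For the Sierpiński topology of `Prop` a continuous map is an open set, so open sets too can be
  -- glued from simplices.
  obtain ⟨f, hf⟩ := exists_realization_desc (X := nerve D) (ULift.{max u v} Prop)
    (fun n (σ : ComposableArrows D n) ↦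
      ⟨fun t ↦ ⟨∃ i, σ.obj i = A ∧ 3 / 4 < classMass (IdRel σ) (W.restrict t) i⟩, by
        refine continuous_uliftUp.comp (continuous_Prop.mpr ?_)
        simp only [Set.ofPred_exists, Set.ofPred_and]
        refine isOpen_iUnion fun i ↦ IsOpen.inter isOpen_const (isOpen_lt continuous_const ?_)
        exact (continuous_classMass i).comp W.continuous_restrict⟩) (by
    classical
    intro n m θ (σ : ComposableArrows D n) t
    have hθ : Monotone θ := θ.toOrderHom.monotone
    have hmass : ∀ i : Fin (m + 1), classMass (IdRel σ) (W.restrict (stdSimplex.map θ t)) (θ i) =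
        classMass (IdRel (n := m) ((nerve D).map θ.op σ : (nerve D) _⦋m⦌)) (W.restrict t) i := by
      intro i
      rw [W.restrict_map hθ]
      exact classMass_map (r := IdRel σ) θ (W.restrict t) (θ i) (idRel_map θ σ i)
    refine ULift.ext _ _ (propext ⟨?_, ?_⟩)
    · rintro ⟨i, hi, h⟩
      exact ⟨θ i, hi, (hmass i).symm ▸ h⟩
    · rintro ⟨j, hj, h⟩
      -- A class that misses the image of `θ` has mass `0` after pushing forward, so a heavy class
      -- meets the image.
      obtain ⟨i, hi⟩ : ∃ i, IdRel σ j (θ i) := by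
        by_contra! hne
        rw [W.restrict_map hθ, classMass_map (r := IdRel σ) θ (W.restrict t) j (r' := fun _ ↦ False)
          (fun i ↦ by simpa using hne i)] at h
        norm_num at h
      refine ⟨i, hi.obj_eq.symm.trans hj, ?_⟩
      rw [classMass_congr (idRel_equivalence σ) _ hi] at h
      exact (hmass i) ▸ h)
  refine ⟨{p | (f p).down}, ?_, fun n σ t ↦ ?_⟩
  · exact continuous_Prop.mp (continuous_uliftDown.comp f.continuous)
  · exact iff_of_eq (congrArg ULift.down (hf n σ t))

end Cover

/-! ### Every path between vertices is a composite of edges -/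

section EdgeInduction

variable {D : Type u} [Category.{v} D]

lemma exists_chain_simplexMap_eq (p : ClassifyingSpace D) :
    ∃ (n : ℕ) (σ : ComposableArrows D n) (t : stdSimplex ℝ (Fin (n + 1))),
      simplexMap (X := nerve D) σ t = p :=
  exists_simplexMap_eq p

lemma Path.Homotopic.Quotient.symm_symm {Y : Type*} [TopologicalSpace Y] {a b : Y}
    (α : Path.Homotopic.Quotient a b) : α.symm.symm = α := by
  induction α using Path.Homotopic.Quotient.ind with | mk α =>
  rw [← mk_symm, ← mk_symm, Path.symm_symm]

lemma Path.Homotopic.Quotient.trans_symm_rev {Y : Type*} [TopologicalSpace Y] {a b c : Y}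
    (α : Path.Homotopic.Quotient a b) (β : Path.Homotopic.Quotient b c) :
    (α.trans β).symm = β.symm.trans α.symm := by
  induction α using Path.Homotopic.Quotient.ind with | mk α =>
  induction β using Path.Homotopic.Quotient.ind with | mk β =>
  rw [← mk_trans, ← mk_symm, ← mk_symm, ← mk_symm, ← mk_trans, Path.trans_symm]

/-- The track of a point under the contraction is homotopic to any path in a simplex to the vertex
on which the point is concentrated. -/
lemma mk_track_eq_vertexClass (W : Window) {n : ℕ} (σ : ComposableArrows D n)
    (t : stdSimplex ℝ (Fin (n + 1))) (i : Fin (n + 1))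
    (hi : 3 / 4 < classMass (IdRel σ) (W.restrict t) i)
    (η : Path (simplexMap (X := nerve D) σ t) (classPt (σ.obj i)))
    (hη : ∀ s, η s = simplexMap (X := nerve D) σ (contract W (idRel_equivalence σ) s t)) :
    Path.Homotopic.Quotient.mk η = vertexClass σ t i := by
  let t₁ := contract W (idRel_equivalence σ) 1 t
  have ht₁ : ∀ j, t₁ j ≠ 0 → IdRel σ i j := fun j hj ↦ contract_one_apply W _ hi hj
  let α : Path t t₁ := ⟨⟨fun s ↦ contract W (idRel_equivalence σ) s t,
    (continuous_contract W (idRel_equivalence σ)).comp (Continuous.prodMk_right t)⟩, contract_zero W (idRel_equivalence σ) t,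
    rfl⟩
  have hline : ∀ s : unitInterval, ((1 - (s : ℝ)) • t₁.1 + (s : ℝ) • (stdSimplex.vertex (S := ℝ) i).1) ∈
      stdSimplex ℝ (Fin (n + 1)) := fun s ↦
    convex_stdSimplex ℝ _ t₁.2 (stdSimplex.vertex i).2 (sub_nonneg.mpr s.2.2) s.2.1 (by ring)
  -- The segment from the end of the track to vertex `i` stays in the face of the class of `i`,
  -- which is collapsed to one point of `|D|`.
  let β : Path t₁ (stdSimplex.vertex i) :=
    ⟨⟨fun s ↦ ⟨_, hline s⟩, Continuous.subtype_mk (by fun_prop) _⟩,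
      stdSimplex.ext (funext fun j ↦ by
        change (1 - ((0 : unitInterval) : ℝ)) * t₁ j + ((0 : unitInterval) : ℝ) * _ = _
        simp),
      stdSimplex.ext (funext fun j ↦ by
        change (1 - ((1 : unitInterval) : ℝ)) * t₁ j + ((1 : unitInterval) : ℝ) * (stdSimplex.vertex (S := ℝ) i) j = _
        simp)⟩
  have hβ : ∀ s, simplexMap (X := nerve D) σ (β s) = classPt (σ.obj i) := by
    intro s
    refine simplexMap_eq_classPt σ _ i fun j hj ↦ ?_
    by_cases hij : j = i
    · rw [hij]
      exact (idRel_equivalence σ).refl i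
    · apply ht₁
      intro h₀
      apply hj
      change (1 - (s : ℝ)) * t₁ j + (s : ℝ) * (stdSimplex.vertex (S := ℝ) i) j = 0
      rw [h₀, stdSimplex.vertex_coe, Pi.single_eq_of_ne hij]
      ring
  rw [vertexClass_eq σ t i (α.trans β), ← Path.Homotopic.Quotient.trans_refl (.mk η), ← Path.Homotopic.Quotient.mk_refl,
    ← Path.Homotopic.Quotient.mk_trans]
  congr 1
  ext s
  rw [Path.cast_coe, Path.map_coe, Function.comp_apply, Path.trans_apply, Path.trans_apply]
  split_ifs
  · exact hη _
  · exact (hβ _).symm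

/-- Every path between vertices of the classifying space is homotopic to a composite of edges and
inverses of edges, as an induction principle. -/
theorem edge_induction {P : ∀ A B : D, Path.Homotopic.Quotient (classPt A) (classPt B) → Prop}
    (edge : ∀ {A B : D} (f : A ⟶ B), P A B (.mk (classPath f)))
    (trans : ∀ {A B B' : D} {α : Path.Homotopic.Quotient (classPt A) (classPt B)}
      {β : Path.Homotopic.Quotient (classPt B) (classPt B')},
      P A B α → P B B' β → P A B' (α.trans β))
    (symm : ∀ {A B : D} {α : Path.Homotopic.Quotient (classPt A) (classPt B)},
      P A B α → P B A α.symm)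
    {A B : D} (γ : Path.Homotopic.Quotient (classPt A) (classPt B)) : P A B γ := by
  choose K hK using fun W ↦ exists_contraction (D := D) W
  choose U hUo hU using fun W A ↦ exists_heavy_open (D := D) W A
  -- Each point gets one reference path, to the initial vertex of a simplex containing it. It
  -- differs from the track of any applicable window by a single edge, so changing windows at a
  -- point costs only edges.
  have hrad : ∀ p : ClassifyingSpace D, ∃ (A : D) (ρ : Path.Homotopic.Quotient p (classPt A)),
      ∀ (W : Window) (B : D) (η : Path p (classPt B)), p ∈ U W B → (∀ s, η s = K W p s) →
        P A B (ρ.symm.trans (.mk η)) := by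
    intro p
    obtain ⟨n, σ, t, rfl⟩ := exists_chain_simplexMap_eq p
    refine ⟨σ.obj 0, vertexClass σ t 0,
      fun W B η hp hη ↦ ?_⟩
    obtain ⟨i, rfl, hi⟩ := (hU W B n σ t).mp hp
    rw [mk_track_eq_vertexClass W σ t i hi η fun s ↦ (hη s).trans (hK W n σ t s),
      ← vertexClass_trans_edge σ t (Fin.zero_le i),
      ← Path.Homotopic.Quotient.trans_assoc, Path.Homotopic.Quotient.symm_trans,
      Path.Homotopic.Quotient.refl_trans]
    exact edge _
  choose base ρ hρ using hrad
  have hK₀ : ∀ (W : Window) (p : ClassifyingSpace D), K W p 0 = p := by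
    intro W p
    obtain ⟨n, σ, t, rfl⟩ := exists_chain_simplexMap_eq p
    exact (hK W n σ t 0).trans (congrArg _ (contract_zero W _ t))
  have hK₁ : ∀ (W : Window) (B : D) (p : ClassifyingSpace D), p ∈ U W B →
      K W p 1 = classPt B := by
    intro W B p hp
    obtain ⟨n, σ, t, rfl⟩ := exists_chain_simplexMap_eq p
    obtain ⟨i, rfl, hi⟩ := (hU W B n σ t).mp hp
    refine (hK W n σ t 1).trans (simplexMap_eq_classPt σ _ i fun j hj ↦ ?_)
    exact contract_one_apply W _ hi hj
  have hcover : ∀ p : ClassifyingSpace D, ∃ (W : Window) (B : D), p ∈ U W B := by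
    intro p
    obtain ⟨n, σ, t, rfl⟩ := exists_chain_simplexMap_eq p
    obtain ⟨W, i, hi⟩ := Window.exists_restrict_eq_one t
    refine ⟨W, _, (hU W _ n σ t).mpr ⟨i, rfl, ?_⟩⟩
    refine lt_of_lt_of_le (by rw [hi]; norm_num) (Finset.single_le_sum
      (fun j _ ↦ stdSimplex.zero_le _ j) ?_ : W.restrict t i ≤ _)
    simpa using (idRel_equivalence σ).refl i
  -- The reference path at a vertex may come from a larger simplex containing it. Presented as a
  -- `0`-simplex, however, the vertex has a constant track, and comparison with this track gives the
  -- claim.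
  have hvertex : ∀ (A : D) (p : ClassifyingSpace D) (h : p = classPt A),
      P A (base p) ((ρ p).cast h.symm rfl) := by
    rintro A _ rfl
    obtain ⟨W, B, hB⟩ := hcover (classPt A)
    obtain ⟨i, rfl, hi⟩ := (hU W B 0 (ComposableArrows.mk₀ A) default).mp hB
    have h := hρ _ W A (Path.refl _) hB fun s ↦ by
      refine Eq.symm ((hK W 0 (ComposableArrows.mk₀ A) default s).trans ?_)
      exact congrArg (simplexMap (X := nerve D) (n := 0) (ComposableArrows.mk₀ A))
        (Subsingleton.elim _ _)
    rw [Path.Homotopic.Quotient.mk_refl, Path.Homotopic.Quotient.trans_refl] at h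
    rw [Path.Homotopic.Quotient.cast_rfl_rfl, ← (ρ (classPt A)).symm_symm]
    exact symm h
  induction γ using Path.Homotopic.Quotient.ind with | mk γ =>
  let initial (x : unitInterval) : Path.Homotopic.Quotient (classPt A) (γ x) :=
    (Path.Homotopic.Quotient.mk (γ.subpath 0 x)).cast γ.source.symm rfl
  have hstep : ∀ (W : Window) (B : D) (x y : unitInterval), x ≤ y →
      (∀ z ∈ Set.Icc x y, γ z ∈ U W B) → P A (base (γ x)) ((initial x).trans (ρ (γ x))) →
        P A (base (γ y)) ((initial y).trans (ρ (γ y))) := by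
    intro W B x y hxy hz hx
    have hxU := hz x ⟨le_rfl, hxy⟩
    have hyU := hz y ⟨hxy, le_rfl⟩
    let η (z : ClassifyingSpace D) (hz : z ∈ U W B) : Path z (classPt B) :=
      ⟨K W z, hK₀ W z, hK₁ W B z hz⟩
    let H : C(unitInterval × unitInterval, ClassifyingSpace D) :=
      ContinuousMap.uncurry ((K W).comp (γ.subpath x y).toContinuousMap)
    -- While the path stays in one open set all tracks end at the same vertex. The fourth side of
    -- the square is therefore constant, and the subpath is the track of `γ x` followed by the
    -- reversed track of `γ y`.
    have hsq := homotopic_of_square H (γ.subpath x y) (η _ hyU) (η _ hxU) (Path.refl _)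
      (fun s ↦ (hK₀ W _).symm) (fun s ↦ by
        change K W (γ y) s = K W (γ.subpath x y 1) s
        rw [Path.target]) (fun s ↦ by
        change K W (γ x) s = K W (γ.subpath x y 0) s
        rw [Path.source]) (fun s ↦ by
        refine (hK₁ W B _ ?_).symm
        have : γ.subpath x y s ∈ Set.range (γ.subpath x y) := ⟨s, rfl⟩
        rw [Path.range_subpath_of_le _ _ _ hxy] at this
        obtain ⟨z, hz', hz''⟩ := this
        exact hz'' ▸ hz z hz')
    have hsq' := Path.Homotopic.Quotient.eq.mpr hsq
    rw [Path.Homotopic.Quotient.mk_trans, Path.Homotopic.Quotient.mk_trans,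
      Path.Homotopic.Quotient.mk_refl, Path.Homotopic.Quotient.trans_refl] at hsq'
    have hinit : (initial x).trans (.mk (γ.subpath x y)) = initial y :=
      Path.Homotopic.Quotient.eq.mpr
        (Path.Homotopic.pathCast ⟨Path.Homotopy.subpathTransSubpath γ 0 x y⟩ γ.source.symm rfl)
    have h := trans (trans hx (hρ (γ x) W B (η _ hxU) hxU fun _ ↦ rfl))
      (symm (hρ (γ y) W B (η _ hyU) hyU fun _ ↦ rfl))
    rw [← hsq'] at h
    rw [← hinit]
    convert h using 1
    simp only [Path.Homotopic.Quotient.trans_symm_rev, Path.Homotopic.Quotient.symm_symm,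
      Path.Homotopic.Quotient.trans_assoc]
    rw [← Path.Homotopic.Quotient.trans_assoc (ρ (γ x)) (ρ (γ x)).symm,
      Path.Homotopic.Quotient.trans_symm, Path.Homotopic.Quotient.refl_trans,
      ← Path.Homotopic.Quotient.trans_assoc (.mk (η _ hyU)),
      Path.Homotopic.Quotient.trans_symm, Path.Homotopic.Quotient.refl_trans]
  obtain ⟨x, hx₀, hmono, ⟨N, hN⟩, hx⟩ := exists_monotone_Icc_subset_open_cover_unitInterval
    (c := fun i : Window × D ↦ γ ⁻¹' U i.1 i.2)
    (fun i ↦ (hUo i.1 i.2).preimage γ.continuous)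
    (fun z _ ↦ by
      obtain ⟨W, B, h⟩ := hcover (γ z)
      exact Set.mem_iUnion.mpr ⟨(W, B), h⟩)
  have hall : ∀ k, P A (base (γ (x k))) ((initial (x k)).trans (ρ (γ (x k)))) := by
    intro k
    induction k with
    | zero =>
      rw [hx₀]
      convert hvertex A (γ 0) γ.source using 1
      have hcast : ∀ (p : ClassifyingSpace D) (h : p = classPt A),
          ((Path.Homotopic.Quotient.refl p).cast h.symm rfl).trans (ρ p) =
            (ρ p).cast h.symm rfl := by
        rintro _ rfl
        simp
      refine Eq.trans ?_ (hcast _ γ.source)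
      simp only [initial, Path.subpath_self, Path.Homotopic.Quotient.mk_refl]
    | succ k ih =>
      obtain ⟨⟨W, B⟩, h⟩ := hx k
      exact hstep W B _ _ (hmono (Nat.le_succ k)) (fun z hz ↦ h hz) ih
  have hfin : ∀ (p : ClassifyingSpace D) (h : p = classPt B)
      (α : Path.Homotopic.Quotient (classPt A) p), P A (base p) (α.trans (ρ p)) →
        P A B (α.cast rfl h.symm) := by
    rintro _ rfl α hα
    have := trans hα (symm (hvertex B _ rfl))
    rw [Path.Homotopic.Quotient.cast_rfl_rfl] at this ⊢
    rwa [Path.Homotopic.Quotient.trans_assoc, Path.Homotopic.Quotient.trans_symm,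
      Path.Homotopic.Quotient.trans_refl] at this
  have h₁ := hall N
  rw [hN N le_rfl] at h₁
  convert hfin _ γ.target _ h₁ using 1
  simp only [initial, Path.subpath_zero_one]
  rfl

end EdgeInduction

/-! ### The two homomorphisms between the presented group and the fundamental group -/

namespace CGWCategory

variable {C : Type u} [Category.{v} (EObj C)] [Category.{w} (MObj C)] (S : CGWCategory C)

/-! ### Relations in the presented group -/

lemma objClass_zero : S.objClass S.zero = 0 :=
  (QuotientAddGroup.eq_zero_iff _).mpr (AddSubgroup.subset_closure (Set.mem_insert _ _))

variable {S} in
lemma objClass_dist {A B D E : C} {t : A ⟶ₘ B} {l : A ⟶ₑ D} {r : B ⟶ₑ E} {b : D ⟶ₘ E}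
    (h : S.IsDist t l r b) :
    S.objClass D + S.objClass B = S.objClass A + S.objClass E := by
  rw [← sub_eq_zero]
  exact (QuotientAddGroup.eq_zero_iff _).mpr (AddSubgroup.subset_closure
    (Set.mem_insert_of_mem _ ⟨A, B, D, E, t, l, r, b, h, rfl⟩))

/-- The first square of axiom (I) reads `[B] + [B] = [A] + [B]`. This makes the degree independent
of the representing span. -/
lemma objClass_iso {A B : C} (i : A ≅ₑ B) : S.objClass A = S.objClass B :=
  (add_right_cancel (objClass_dist (S.dist_iso₁ i))).symm

/-- The degree of a morphism `A ⟶ₑ X ⟶ₘ B` of `Q C` is `[X] - [A]`. -/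
def degree {A B : S.Q} (f : A ⟶ B) : S.PresentedK₀ :=
  Quotient.lift (s := S.qSetoid A.obj B.obj) (fun p ↦ S.objClass p.mid - S.objClass A.obj)
    (by
      rintro p q ⟨i, -⟩
      rw [S.objClass_iso i]) f

lemma degree_qHom {A X B : C} (e : A ⟶ₑ X) (m : X ⟶ₘ B) :
    S.degree (S.qHom e m) = S.objClass X - S.objClass A := rfl

lemma degree_id (A : S.Q) : S.degree (𝟙 A) = 0 := sub_self _

variable {S} in
lemma qHom_comp {A B D X Y Z : C} {e : A ⟶ₑ X} {m : X ⟶ₘ B} {e' : B ⟶ₑ Y} {m' : Y ⟶ₘ D}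
    {l : X ⟶ₑ Z} {b : Z ⟶ₘ Y} (h : S.IsDist m l e' b) :
    S.qHom e m ≫ S.qHom e' m' = S.qHom (e ≫ l) (b ≫ m') :=
  S.qComp_mk h

lemma exists_eq_qHom {A B : C} (f : (Q.mk A : S.Q) ⟶ Q.mk B) :
    ∃ (X : C) (e : A ⟶ₑ X) (m : X ⟶ₘ B), f = S.qHom e m := by
  induction f using Quotient.inductionOn with | h p =>
  exact ⟨p.mid, p.e, p.m, rfl⟩

/-- The square that computes the composite gives `[Z] + [B] = [X] + [Y]`, that is, `[Z] - [A] = ([X]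
- [A]) + ([Y] - [B])`. -/
lemma degree_comp {A B D : S.Q} (f : A ⟶ B) (g : B ⟶ D) :
    S.degree (f ≫ g) = S.degree f + S.degree g := by
  obtain ⟨X, e, m, rfl⟩ := S.exists_eq_qHom (A := A.obj) (B := B.obj) f
  obtain ⟨Y, e', m', rfl⟩ := S.exists_eq_qHom (A := B.obj) (B := D.obj) g
  obtain ⟨Z, l, b, h⟩ := S.exists_dist m e'
  have h₁ : S.degree (S.qHom e m ≫ S.qHom e' m') = S.objClass Z - S.objClass A.obj :=
    congrArg S.degree (qHom_comp h)
  have h₂ := objClass_dist h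
  refine h₁.trans ?_
  rw [degree_qHom, degree_qHom, eq_sub_of_add_eq h₂]
  abel

/-! ### Loops of morphisms -/

/-- The point of `|Q C|` given by an object, as an object of the fundamental groupoid. -/
noncomputable abbrev pt (A : S.Q) : FundamentalGroupoid (ClassifyingSpace S.Q) := ⟨classPt A⟩

/-- The edge of a morphism of `Q C`, as a morphism of the fundamental groupoid. -/
noncomputable def edge {A B : S.Q} (f : A ⟶ B) : S.pt A ⟶ S.pt B :=
  Path.Homotopic.Quotient.mk (classPath f)

lemma edge_comp {A B D : S.Q} (f : A ⟶ B) (g : B ⟶ D) :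
    S.edge (f ≫ g) = S.edge f ≫ S.edge g :=
  mk_classPath_comp f g

lemma edge_id (A : S.Q) : S.edge (𝟙 A) = 𝟙 _ := by
  rw [← cancel_epi (S.edge (𝟙 A)), ← edge_comp, Category.comp_id, Category.comp_id]

/-- The morphism `∅ ⟶ A` of `Q C` given by an m-morphism. -/
noncomputable def base (A : S.Q) : (Q.mk S.zero : S.Q) ⟶ A :=
  S.qHom (𝟙 (EObj.mk S.zero)) (S.zeroM.to (MObj.mk A.obj))

/-- A path between two points of `|Q C|`, completed to a loop at `∅`. -/
noncomputable def loop {A B : S.Q} (α : S.pt A ⟶ S.pt B) : S.K₀ :=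
  S.edge (S.base A) ≫ α ≫ inv (S.edge (S.base B))

lemma loop_comp {A B D : S.Q} (α : S.pt A ⟶ S.pt B) (β : S.pt B ⟶ S.pt D) :
    S.loop (α ≫ β) = S.loop β * S.loop α := by
  simp [loop, End.mul_def]

lemma loop_id (A : S.Q) : S.loop (𝟙 (S.pt A)) = 1 := by
  simp [loop, End.one_def]

lemma loop_inv {A B : S.Q} (α : S.pt A ⟶ S.pt B) : S.loop (inv α) = (S.loop α)⁻¹ := by
  rw [eq_inv_iff_mul_eq_one, ← loop_comp, IsIso.hom_inv_id, loop_id]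

lemma base_comp_qHom {A B : C} (m : A ⟶ₘ B) :
    S.base (Q.mk A) ≫ S.qHom (𝟙 _) m = S.base (Q.mk B) := by
  refine (qHom_comp (S.dist_idE _)).trans ?_
  rw [Category.comp_id, base, S.zeroM.hom_ext (S.zeroM.to _ ≫ m) (S.zeroM.to _)]

/-- Since `∅` is initial in `M`, the base path of `A` followed by `m` is the base path of `B`: the
base paths serve as a maximal tree. -/
lemma loop_edge_m {A B : C} (m : A ⟶ₘ B) :
    S.loop (S.edge (S.qHom (𝟙 (EObj.mk A)) m)) = 1 := by
  rw [loop, ← Category.assoc, ← edge_comp, base_comp_qHom, IsIso.hom_inv_id]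
  rfl

/-- The loop of an e-morphism. -/
noncomputable def eLoop {A B : C} (e : A ⟶ₑ B) : S.K₀ :=
  S.loop (S.edge (S.qHom e (𝟙 (MObj.mk B))))

lemma loop_edge_qHom {A X B : C} (e : A ⟶ₑ X) (m : X ⟶ₘ B) :
    S.loop (S.edge (S.qHom e m)) = S.eLoop e := by
  have h : S.qHom e (𝟙 _) ≫ S.qHom (𝟙 _) m = S.qHom e m := by
    refine (qHom_comp (S.dist_idE (𝟙 _))).trans ?_
    rw [Category.comp_id, Category.id_comp]
  rw [← h, edge_comp, loop_comp, loop_edge_m, one_mul, eLoop]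

lemma eLoop_comp {A B D : C} (e : A ⟶ₑ B) (e' : B ⟶ₑ D) :
    S.eLoop (e ≫ e') = S.eLoop e' * S.eLoop e := by
  have h : S.qHom e (𝟙 _) ≫ S.qHom e' (𝟙 _) = S.qHom (e ≫ e') (𝟙 _) := by
    refine (qHom_comp (S.dist_idM e')).trans ?_
    rw [Category.id_comp]
  rw [eLoop, ← h, edge_comp, loop_comp, eLoop, eLoop]

-- The span `(l, b)` is the composite of `t` with `r` in `Q C`, and the m-morphisms `t` and `b`
-- contribute nothing to the loop.
variable {S} in
lemma eLoop_dist {A B D E : C} {t : A ⟶ₘ B} {l : A ⟶ₑ D} {r : B ⟶ₑ E} {b : D ⟶ₘ E}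
    (h : S.IsDist t l r b) : S.eLoop l = S.eLoop r := by
  have h' : S.qHom (𝟙 _) t ≫ S.qHom r (𝟙 _) = S.qHom l b := by
    refine (qHom_comp h).trans ?_
    rw [Category.id_comp, Category.comp_id]
  rw [← S.loop_edge_qHom l b, ← h', edge_comp, loop_comp, loop_edge_m, mul_one, eLoop]

lemma base_zero : S.base (Q.mk S.zero) = 𝟙 _ := by
  rw [base, S.zeroM.hom_ext (S.zeroM.to _) (𝟙 _)]
  rfl

lemma eLoop_zeroE (A : C) : S.eLoop (S.zeroE.to (EObj.mk A)) = S.loopClass A := by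
  rw [eLoop, loop, base_zero, edge_id, Category.id_comp, ← Groupoid.inv_eq_inv]
  rfl

/-- Axiom (K) places `g` opposite `∅ → A^{k/g}` in a distinguished square. Hence the loops of
objects already account for all edges. -/
lemma eLoop_eq_loopClass {A B : C} (g : A ⟶ₑ B) : S.eLoop g = S.loopClass (S.k.obj g) := by
  rw [← eLoop_zeroE, eLoop_dist (S.dist_k g)]

lemma loopClass_mul {A B : C} (g : A ⟶ₑ B) : S.eLoop g * S.loopClass A = S.loopClass B := by
  rw [← eLoop_zeroE, ← eLoop_zeroE, ← eLoop_comp]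
  congr 1
  exact S.zeroE.hom_ext _ _

/-- The two squares of axiom (A) compute the loop of the same object `X` as the product of those of
`A` and `B` in either order. -/
lemma loopClass_commute (A B : C) : Commute (S.loopClass A) (S.loopClass B) := by
  obtain ⟨X, ⟨g, f, h⟩, ⟨g', f', h'⟩⟩ := S.exists_sum A B
  have e₁ := S.loopClass_mul g
  have e₂ := S.loopClass_mul g'
  rw [← eLoop_dist h, eLoop_zeroE] at e₁
  rw [← eLoop_dist h', eLoop_zeroE] at e₂
  exact e₂.trans e₁.symm

/-- The fundamental group of `|Q C|` is generated by the loops of the objects. -/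
theorem closure_loopClass : Subgroup.closure (Set.range S.loopClass) = ⊤ := by
  have key : ∀ {A B : S.Q} (α : S.pt A ⟶ S.pt B),
      S.loop α ∈ Subgroup.closure (Set.range S.loopClass) := by
    intro A B α
    refine edge_induction (P := fun A B α ↦
      S.loop (A := A) (B := B) α ∈ Subgroup.closure (Set.range S.loopClass)) ?_ ?_ ?_ α
    · intro A B f
      obtain ⟨X, e, m, rfl⟩ := S.exists_eq_qHom (A := A.obj) (B := B.obj) f
      have h := S.loop_edge_qHom e m
      rw [eLoop_eq_loopClass] at h
      exact Subgroup.subset_closure ⟨_, h.symm⟩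
    · intro A B D α β hα hβ
      have h := mul_mem hβ hα
      rwa [← loop_comp] at h
    · intro A B α hα
      have h := inv_mem hα
      rwa [← loop_inv, ← Groupoid.inv_eq_inv] at h
  refine eq_top_iff.mpr fun γ _ ↦ ?_
  -- The base path of `∅` is the edge of an identity, so completing `γ` to a loop at `∅` does not
  -- change it.
  have h := key (A := Q.mk S.zero) (B := Q.mk S.zero) γ
  simp only [loop, base_zero, edge_id, IsIso.inv_id, Category.comp_id] at h
  rwa [Category.id_comp] at h

lemma mul_comm_K₀ (x y : S.K₀) : x * y = y * x := by
  have hx : x ∈ Subgroup.closure (Set.range S.loopClass) := S.closure_loopClass ▸ Subgroup.mem_top x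
  have hy : y ∈ Subgroup.closure (Set.range S.loopClass) := S.closure_loopClass ▸ Subgroup.mem_top y
  refine Subgroup.closure_induction₂ (p := fun x y _ _ ↦ Commute x y) ?_ ?_ ?_ ?_ ?_ ?_ ?_ hx hy
  · rintro _ _ ⟨A, rfl⟩ ⟨B, rfl⟩
    exact S.loopClass_commute A B
  · exact fun _ _ ↦ Commute.one_left _
  · exact fun _ _ ↦ Commute.one_right _
  · exact fun _ _ _ _ _ _ ↦ Commute.mul_left
  · exact fun _ _ _ _ _ _ ↦ Commute.mul_right
  · exact fun _ _ _ _ ↦ Commute.inv_left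
  · exact fun _ _ _ _ ↦ Commute.inv_right

-- The e-sides have a common loop `x`, with `[D] = x [A]` and `[E] = x [B]`; commutativity does the
-- rest.
variable {S} in
lemma loopClass_dist {A B D E : C} {t : A ⟶ₘ B} {l : A ⟶ₑ D} {r : B ⟶ₑ E} {b : D ⟶ₘ E}
    (h : S.IsDist t l r b) :
    S.loopClass D * S.loopClass B = S.loopClass A * S.loopClass E := by
  rw [← S.loopClass_mul l, ← S.loopClass_mul r, eLoop_dist h, S.mul_comm_K₀ (S.eLoop r),
    mul_assoc]

lemma loopClass_zero : S.loopClass S.zero = 1 := by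
  have h := S.loopClass_mul (𝟙 (EObj.mk S.zero))
  have h' := S.eLoop_zeroE S.zero
  rw [S.zeroE.hom_ext (S.zeroE.to _) (𝟙 _)] at h'
  rwa [h', mul_eq_right] at h

/-- The commutative group structure of `K₀`. -/
noncomputable abbrev commGroupK₀ : CommGroup S.K₀ :=
  { (inferInstance : Group S.K₀) with mul_comm := S.mul_comm_K₀ }

/-- The homomorphism `[A] ↦ loopClass A`. -/
theorem exists_hom_presentedK₀ : ∃ Φ : S.PresentedK₀ →+ Additive S.K₀,
    ∀ A, Φ (S.objClass A) = Additive.ofMul (S.loopClass A) := by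
  let _ := S.commGroupK₀
  let Φ₀ : FreeAbelianGroup C →+ Additive S.K₀ :=
    FreeAbelianGroup.lift fun A ↦ Additive.ofMul (S.loopClass A)
  have hΦ₀ : ∀ A, Φ₀ (FreeAbelianGroup.of A) = Additive.ofMul (S.loopClass A) :=
    fun A ↦ FreeAbelianGroup.lift_apply_of _ A
  refine ⟨QuotientAddGroup.lift _ Φ₀ ((AddSubgroup.closure_le _).mpr ?_), hΦ₀⟩
  rintro _ (rfl | ⟨A, B, D, E, t, l, r, b, h, rfl⟩)
  · exact (hΦ₀ _).trans (congrArg Additive.ofMul S.loopClass_zero)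
  · change Φ₀ _ = 0
    rw [map_sub, map_add, map_add, hΦ₀, hΦ₀, hΦ₀, hΦ₀, sub_eq_zero]
    exact congrArg Additive.ofMul (loopClass_dist h)

/-- The degree, as a homomorphism on the fundamental group of `|Q C|`. -/
theorem exists_hom_K₀ : ∃ Ψ : Additive S.K₀ →+ S.PresentedK₀,
    ∀ A, Ψ (Additive.ofMul (S.loopClass A)) = S.objClass A := by
  -- The coefficient group is lifted to the universe of the classifying space. As it is commutative,
  -- it is also its own opposite.
  let G := ULift.{max v w} (Multiplicative S.PresentedK₀)
  obtain ⟨ψ, hψ⟩ := exists_fundamentalGroup_hom (D := S.Q) (G := G)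
    (fun f ↦ ⟨Multiplicative.ofAdd (S.degree f)⟩)
    (fun A ↦ congrArg (fun x ↦ (⟨Multiplicative.ofAdd x⟩ : G)) (S.degree_id A))
    (fun f g ↦ congrArg (fun x ↦ (⟨Multiplicative.ofAdd x⟩ : G)) (S.degree_comp f g))
    (Q.mk S.zero)
  let ψ' : S.K₀ →* Multiplicative S.PresentedK₀ :=
    (MulEquiv.ulift.toMonoidHom.comp (MulOpposite.opMulEquiv (M := G)).symm.toMonoidHom).comp ψ
  refine ⟨MonoidHom.toAdditiveLeft ψ', fun A ↦ ?_⟩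
  have h := congrArg (fun x : Gᵐᵒᵖ ↦ Multiplicative.toAdd x.unop.down) (hψ (Q.mk A)
    (S.qHom (S.zeroE.to (EObj.mk A)) (𝟙 (MObj.mk A)))
    (S.qHom (𝟙 (EObj.mk S.zero)) (S.zeroM.to (MObj.mk A))))
  refine h.trans ?_
  simp [degree_qHom, objClass_zero, G]

end CGWCategory
/-- For a CGW-category, `K₀(C) = π₁(|Q C|, ∅)` is the free abelian group on the objects modulo `[∅] = 0`
and `[D] + [B] = [A] + [E]` for every distinguished square, the generator `[A]` being the class of the
loop formed by the two canonical morphisms `∅ ⟶ A` of `Q C`. -/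
theorem mainTheorem4 {C : Type u} [Category.{v} (EObj C)] [Category.{w} (MObj C)]
    (S : CGWCategory C) :
    ∃ Φ : S.PresentedK₀ ≃+ Additive S.K₀,
      ∀ A : C, Φ (S.objClass A) = Additive.ofMul (S.loopClass A) := by
  obtain ⟨Φ, hΦ⟩ := S.exists_hom_presentedK₀
  obtain ⟨Ψ, hΨ⟩ := S.exists_hom_K₀
  have hinj : Function.Injective Φ := by
    have h : Ψ.comp Φ = AddMonoidHom.id _ := by
      ext A
      exact (congrArg Ψ (hΦ A)).trans (hΨ A)
    exact Function.LeftInverse.injective (g := Ψ) (DFunLike.congr_fun h)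
  have hsurj : Function.Surjective Φ := by
    intro x
    have hx : x.toMul ∈ Subgroup.closure (Set.range S.loopClass) :=
      S.closure_loopClass ▸ Subgroup.mem_top _
    -- The range of `Φ` is a subgroup containing the loops of all objects, which generate.
    have hle : Subgroup.closure (Set.range S.loopClass) ≤ AddSubgroup.toSubgroup' Φ.range := by
      rw [Subgroup.closure_le]
      rintro _ ⟨A, rfl⟩
      exact ⟨S.objClass A, hΦ A⟩
    exact hle hx
  exact ⟨AddEquiv.ofBijective Φ ⟨hinj, hsurj⟩, hΦ⟩
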